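/- Let $M$ be a compact, connected, smooth Riemannian surface without boundary, let $\mu$ be its normalized area measure, and let $R\colon M\to M$ be a $C^1$ diffeomorphism with $R\circ R=\mathrm{Id}$ whose derivative $DR_x\colon T_xM\to T_{R(x)}M$ preserves (unsigned) area, that is, $|\det DR_x|=1$ with respect to the Riemannian metric, for every $x\in M$. Let $\mathrm{Diff}^1_{\mu,R}(M)$ be the set of $C^1$ diffeomorphisms $f\colon M\to M$ with $f_*\mu=\mu$ and $R\circ f=f^{-1}\circ R$. Let $f\in\mathrm{Diff}^1_{\mu,R}(M)$ and let $X\subset M$ be a finite set of points whose $f$-orbits are not periodic and which is $(R,f)$-free, i.e. $f(x)\neq R(y)$ for all $x,y\in X$. Then for every neighbourhood $\mathcal U$ of $f$ in the $C^1$ topology (for instance the set of all $g$ that are $\eta$-$C^1$-close to $f$, for a given $\eta>0$) there is $\zeta>0$ with the following property. Let $P$ be a family of linear maps $P(x)\colon T_xM\to T_{f(x)}M$, $x\in X$, with $|\det P(x)|=1$ and $\|P(x)-Df_x\|<\zeta$ for every $x\in X$. Then there is $g\in\mathrm{Diff}^1_{\mu,R}(M)\cap\mathcal U$ such that $$g(x)=f(x)\quad\text{and}\quad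 Dg_x=P(x)\qquad\text{for every }x\in X.$$ Moreover, if $K\subset M$ is compact, $K\cap X=\emptyset$, and no point of $R(f(X))$ is an accumulation point of $K$ (in particular, if $K\cap\bigl(X\cup R(f(X))\bigr)=\emptyset$), then $g$ can be chosen so that in addition $g=f$ on $K$. The number $\zeta$ depends neither on $P$ nor on $K$. -/

import Mathlib

open Set Filter MeasureTheory Bundle
open scoped Topology Manifold ContDiff

noncomputable section

namespace ReversibleSurface

/-- The model space of surfaces. -/
abbrev Plane : Type := EuclideanSpace ℝ (Fin 2)

section Linear

variable {V W : Type*} [NormedAddCommGroup V] [InnerProductSpace ℝ V]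
  [NormedAddCommGroup W] [InnerProductSpace ℝ W]

/-- The area of the parallelogram spanned by two vectors (the square root of their Gram
determinant). -/
def parallelogramArea (v w : V) : ℝ :=
  Real.sqrt (‖v‖ ^ 2 * ‖w‖ ^ 2 - (inner ℝ v w) ^ 2)

/-- A linear map between Euclidean planes that preserves (unsigned) area, that is, whose matrix in
orthonormal bases has determinant `1` or `-1`. -/
def PreservesArea (A : V →L[ℝ] W) : Prop :=
  ∀ v w : V, parallelogramArea (A v) (A w) = parallelogramArea v w

end Linear

section Area

variable (M : Type*) [TopologicalSpace M] [ChartedSpace Plane M]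

/-- Countably many charts cover a compact surface. -/
theorem exists_chart_cover [CompactSpace M] [Nonempty M] :
    ∃ c : ℕ → M, ⋃ n, (chartAt Plane (c n)).source = univ := by
  obtain ⟨s, hs, hU⟩ := countable_cover_nhds_of_sigmaCompact
    (fun x : M => (chartAt Plane x).open_source.mem_nhds (mem_chart_source Plane x))
  have hne : s.Nonempty := by
    obtain ⟨x⟩ := ‹Nonempty M›
    have hx : x ∈ ⋃ y ∈ s, (chartAt Plane y).source := hU ▸ mem_univ x
    simp only [mem_iUnion] at hx
    obtain ⟨y, hy, -⟩ := hx
    exact ⟨y, hy⟩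
  obtain ⟨c, rfl⟩ := hs.exists_eq_range hne
  exact ⟨c, by simpa using hU⟩

/-- The centres of countably many charts that cover `M`. -/
def chartCenter [CompactSpace M] [Nonempty M] : ℕ → M :=
  (exists_chart_cover M).choose

variable {M}
variable [RiemannianBundle (fun x : M => TangentSpace (𝓡 2) x)]

/-- The density `√(det g)` of the Riemannian area in the chart at `c`: the area of the parallelogram
spanned by the two coordinate vectors at the point with coordinates `y`. -/
def chartDensity (c : M) (y : Plane) : ℝ :=
  parallelogramArea
    (mfderiv 𝓘(ℝ, Plane) (𝓡 2) (extChartAt (𝓡 2) c).symm y (EuclideanSpace.single 0 (1 : ℝ)))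
    (mfderiv 𝓘(ℝ, Plane) (𝓡 2) (extChartAt (𝓡 2) c).symm y (EuclideanSpace.single 1 (1 : ℝ)))

variable [MeasurableSpace M]

/-- The Riemannian area of the domain of the chart at `c`, as a measure on `M`. -/
def chartArea (c : M) : Measure M :=
  ((volume.restrict (extChartAt (𝓡 2) c).target).withDensity
    (fun y => ENNReal.ofReal (chartDensity c y))).map (extChartAt (𝓡 2) c).symm

variable (M)

/-- The Riemannian area measure of a compact surface: `M` is cut into countably many pieces, each
one inside a chart domain, and the areas of the pieces are added up. -/
def areaMeasure [CompactSpace M] [Nonempty M] : Measure M :=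
  Measure.sum fun n => (chartArea (chartCenter M n)).restrict
    (disjointed (fun k => (chartAt Plane (chartCenter M k)).source) n)

/-- The area measure, normalized to have total mass `1`. -/
def normalizedArea [CompactSpace M] [Nonempty M] : Measure M :=
  (areaMeasure M univ)⁻¹ • areaMeasure M

end Area

section Diffeo

variable {M : Type*} [TopologicalSpace M] [ChartedSpace Plane M]

variable (M) in
/-- The `C^1` diffeomorphisms of a surface. -/
abbrev Diff1 : Type _ := M ≃ₘ^1⟮𝓡 2, 𝓡 2⟯ M

/-- The set `X` is `(R, f)`-free. -/
def IsFree (R f : M → M) (X : Set M) : Prop :=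
  ∀ x ∈ X, ∀ y ∈ X, f x ≠ R y

/-- The `C^1` topology on the `C^1` diffeomorphisms: the topology of uniform convergence on
compact sets of the tangent maps `TM → TM`. -/
@[reducible] def c1Topology [IsManifold (𝓡 2) 1 M] : TopologicalSpace (Diff1 M) :=
  TopologicalSpace.induced
    (fun f => (⟨tangentMap (𝓡 2) (𝓡 2) f, f.contMDiff.continuous_tangentMap le_rfl⟩ :
      C(TangentBundle (𝓡 2) M, TangentBundle (𝓡 2) M)))
    inferInstance

/-- `f` is an area-preserving `R`-reversible `C^1` diffeomorphism:
`f_* μ = μ` and `R ∘ f = f⁻¹ ∘ R`. -/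
structure IsAreaPreservingReversible
    [RiemannianBundle (fun x : M => TangentSpace (𝓡 2) x)] [MeasurableSpace M]
    [CompactSpace M] [Nonempty M] (R : M → M) (f : Diff1 M) : Prop where
  measurePreserving : MeasurePreserving f (normalizedArea M) (normalizedArea M)
  reversible : ∀ x, R (f x) = f.symm (R x)

end Diffeo

end ReversibleSurface

end

/-!
A perturbation of `f` that stays reversible is obtained from a perturbation `h` of the identity:
since `R ∘ R = id` and `R ∘ f = f⁻¹ ∘ R`, the map `g = R ∘ h⁻¹ ∘ R ∘ f ∘ h` satisfies
`R ∘ g = g⁻¹ ∘ R` whatever `h` is (`reversiblePerturbation`). If `h` is supported in a small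
neighbourhood of `X`, freeness says that `R (f x)` avoids that support for `x ∈ X`, so that near `X`
the map `g` is `f ∘ h`. It thus suffices to find an area-preserving `h`, close to the identity
together with its inverse, which fixes the points `x` of `X` with derivative `(Df_x)⁻¹ ∘ P x`. If
`y ∈ K` and `R (f y)` is in the support of `h`, then, as `R ∘ f` is an involution and no point of
`R (f X)` is an accumulation point of `K`, the point `R (f y)` belongs to `X` and is fixed by `h`;
hence `g = f` on `K`.

The diffeomorphism `h` is built in charts in which the area is the Lebesgue measure
(`exists_areaChart`); such a chart is `(F, y)`, where `F` is a primitive of the density in the first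
coordinate. In the plane, let `N` be a linear map with `N ∘ N = -1`. The quadratic form
`q z = ‖z‖² + ‖N z‖²` is invariant by the rotations `exp (t N)`, and the twist map
`z ↦ exp (a (q z) N) z` preserves area for every function `a` of `q`. If `a` is cut off at the scale
`r`, this map is the identity off a disc of radius `r`, and its `C^1` distance to the identity is
bounded by a multiple of `a 0`, independently of `r` (`exists_twist_bound`). A linear map close to
the identity, of determinant one, is a product of two rotations `exp (β N) ∘ exp (-ε J)`
(`exists_factorization`): when multiplied by a small rotation of fixed angle `ε` it becomes elliptic.
The composition of two twist maps therefore realizes it at the origin (`exists_isSmallAreaMap`). As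
the size of the support is free, the `C^1` estimate in the chart gives closeness in the compact-open
topology of the self-maps of the tangent bundle (`eventually_mapsTo_tangentMap_transport`), with a
`ζ` that depends neither on `P` nor on `K`.

Invariance of the area measure and infinitesimal preservation of area are equivalent for `C^1`
diffeomorphisms (`measurePreserving_of_preservesArea`, `preservesArea_of_measurePreserving`). Both
directions compare the density of a chart with that of its image by the diffeomorphism, through the
expression of the area measure in an arbitrary `C^1` chart (`areaMeasure_apply`). The first one
is used for `R` and `h`, the second one for `f`.
-/

noncomputable section

namespace ReversibleSurface

/-! ### Area factors of linear maps -/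

section AreaFactor

variable {V W : Type*} [NormedAddCommGroup V] [InnerProductSpace ℝ V]
  [NormedAddCommGroup W] [InnerProductSpace ℝ W]

/-- The first coordinate vector of the plane. -/
abbrev e₀ : Plane := EuclideanSpace.single 0 (1 : ℝ)

/-- The second coordinate vector of the plane. -/
abbrev e₁ : Plane := EuclideanSpace.single 1 (1 : ℝ)

/-- The Gram determinant is multiplied by the square of the determinant of the coefficients. -/
lemma parallelogramArea_combination (v w : V) (a b c d : ℝ) :
    parallelogramArea (a • v + b • w) (c • v + d • w) =
      |a * d - b * c| * parallelogramArea v w := by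
  unfold parallelogramArea
  rw [← Real.sqrt_sq_eq_abs, ← Real.sqrt_mul (sq_nonneg _)]
  congr 1
  simp only [← real_inner_self_eq_norm_sq, inner_add_left, inner_add_right, inner_smul_left,
    inner_smul_right, real_inner_comm v w, RCLike.conj_to_real]
  ring

lemma parallelogramArea_pos {v w : V} (h : LinearIndependent ℝ ![v, w]) :
    0 < parallelogramArea v w := by
  refine Real.sqrt_pos.2 ?_
  have hv : v ≠ 0 := by simpa using h.ne_zero 0
  have hv' : 0 < ‖v‖ ^ 2 := by positivity
  -- the component of `w` orthogonal to `v`, up to scaling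
  have hu : 0 < ‖(‖v‖ ^ 2) • w - (inner ℝ v w) • v‖ ^ 2 := by
    have : (‖v‖ ^ 2) • w - (inner ℝ v w) • v ≠ 0 := by
      intro h0
      have := LinearIndependent.pair_iff.1 h (-(inner ℝ v w)) (‖v‖ ^ 2) (by
        rw [← h0]; module)
      exact hv'.ne' this.2
    positivity
  have key : ‖(‖v‖ ^ 2) • w - (inner ℝ v w) • v‖ ^ 2 =
      ‖v‖ ^ 2 * (‖v‖ ^ 2 * ‖w‖ ^ 2 - (inner ℝ v w) ^ 2) := by
    simp only [← real_inner_self_eq_norm_sq, inner_sub_left, inner_sub_right, inner_smul_left,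
      inner_smul_right, real_inner_comm v w, RCLike.conj_to_real]
    ring
  rw [key] at hu
  exact pos_of_mul_pos_right hu hv'.le

lemma plane_eq (v : Plane) : v = v 0 • e₀ + v 1 • e₁ := by
  ext i
  fin_cases i <;> simp

lemma linearIndependent_e : LinearIndependent ℝ ![e₀, e₁] := by
  rw [LinearIndependent.pair_iff]
  intro s t h
  have h0 := congrArg (fun v : Plane => v 0) h
  have h1 := congrArg (fun v : Plane => v 1) h
  simp at h0 h1
  exact ⟨h0, h1⟩

/-- The factor by which a linear map defined on the plane multiplies areas. -/
def areaFactor (S : Plane →L[ℝ] V) : ℝ := parallelogramArea (S e₀) (S e₁)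

lemma parallelogramArea_map (S : Plane →L[ℝ] V) (v w : Plane) :
    parallelogramArea (S v) (S w) = |v 0 * w 1 - v 1 * w 0| * areaFactor S := by
  conv_lhs => rw [plane_eq v, plane_eq w]
  simp only [map_add, map_smul]
  exact parallelogramArea_combination _ _ _ _ _ _

lemma det_plane (B : Plane →L[ℝ] Plane) :
    B.det = (B e₀) 0 * (B e₁) 1 - (B e₀) 1 * (B e₁) 0 := by
  rw [ContinuousLinearMap.det,
    ← LinearMap.det_toMatrix (EuclideanSpace.basisFun (Fin 2) ℝ).toBasis, Matrix.det_fin_two]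
  simp [LinearMap.toMatrix_apply]
  ring

lemma areaFactor_comp (S : Plane →L[ℝ] V) (B : Plane →L[ℝ] Plane) :
    areaFactor (S ∘L B) = |B.det| * areaFactor S := by
  rw [det_plane]
  exact parallelogramArea_map S (B e₀) (B e₁)

lemma areaFactor_pos {S : Plane →L[ℝ] V} (hS : Function.Injective S) : 0 < areaFactor S := by
  refine parallelogramArea_pos ?_
  have h : ![S e₀, S e₁] = (S : Plane →ₗ[ℝ] V) ∘ ![e₀, e₁] := by
    ext i
    fin_cases i <;> rfl
  rw [h]
  exact linearIndependent_e.map' (S : Plane →ₗ[ℝ] V) (LinearMap.ker_eq_bot.2 hS)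

lemma PreservesArea.areaFactor_comp {A : V →L[ℝ] W} (hA : PreservesArea A) (S : Plane →L[ℝ] V) :
    areaFactor (A ∘L S) = areaFactor S := hA _ _

lemma preservesArea_of_areaFactor_comp {A : V →L[ℝ] W} {S : Plane →L[ℝ] V}
    (hS : Function.Surjective S) (h : areaFactor (A ∘L S) = areaFactor S) : PreservesArea A := by
  intro v w
  obtain ⟨v, rfl⟩ := hS v
  obtain ⟨w, rfl⟩ := hS w
  have := parallelogramArea_map (A ∘L S) v w
  rw [h, ← parallelogramArea_map] at this
  exact this

end AreaFactor

/-! ### The density of the Riemannian area in a chart -/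

section Frame

variable {M : Type*} [TopologicalSpace M] [ChartedSpace Plane M]

/-- The differential at `y` of the parametrization of `M` inverse to the chart `e`. -/
def chartFrame (e : OpenPartialHomeomorph M Plane) (y : Plane) :
    Plane →L[ℝ] TangentSpace (𝓡 2) (e.symm y) :=
  mfderiv (𝓡 2) (𝓡 2) e.symm y

lemma chartFrame_bijective [IsManifold (𝓡 2) 1 M] {e : OpenPartialHomeomorph M Plane}
    (he : e ∈ IsManifold.maximalAtlas (𝓡 2) 1 M) {y : Plane} (hy : y ∈ e.target) :
    Function.Bijective (chartFrame e y) := by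
  have h : e.MDifferentiable (𝓡 2) (𝓡 2) :=
    ⟨(contMDiffOn_of_mem_maximalAtlas he).mdifferentiableOn one_ne_zero,
      (contMDiffOn_symm_of_mem_maximalAtlas he).mdifferentiableOn one_ne_zero⟩
  exact h.symm.mfderiv_bijective hy

lemma mdifferentiableAt_symm_chart [IsManifold (𝓡 2) 1 M] {e : OpenPartialHomeomorph M Plane}
    (he : e ∈ IsManifold.maximalAtlas (𝓡 2) 1 M) {y : Plane} (hy : y ∈ e.target) :
    MDifferentiableAt (𝓡 2) (𝓡 2) e.symm y :=
  (contMDiffAt_symm_of_mem_maximalAtlas he hy).mdifferentiableAt one_ne_zero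

variable [RiemannianBundle (fun x : M => TangentSpace (𝓡 2) x)]

/-- The density of the Riemannian area in the chart `e`. -/
def areaDensity (e : OpenPartialHomeomorph M Plane) (y : Plane) : ℝ :=
  areaFactor (chartFrame e y)

lemma chartDensity_eq (c : M) : chartDensity c = areaDensity (chartAt Plane c) := by
  ext y
  rfl

lemma areaDensity_pos [IsManifold (𝓡 2) 1 M] {e : OpenPartialHomeomorph M Plane}
    (he : e ∈ IsManifold.maximalAtlas (𝓡 2) 1 M) {y : Plane} (hy : y ∈ e.target) :
    0 < areaDensity e y :=
  areaFactor_pos (chartFrame_bijective he hy).1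

/-- Maps into the tangent spaces at two equal points that agree as maps into the model plane have the
same area factor. The identification of the tangent spaces with the plane carries no metric, so the
equality of the points is needed. -/
lemma areaFactor_congr {p q : M} (h : p = q) {S : Plane →L[ℝ] TangentSpace (𝓡 2) p}
    {T : Plane →L[ℝ] TangentSpace (𝓡 2) q} (hST : ∀ v, @id Plane (S v) = @id Plane (T v)) :
    areaFactor S = areaFactor T := by
  subst h
  have : S = T := ContinuousLinearMap.ext hST
  rw [this]

/-- A change of parametrization multiplies the density by the absolute value of the Jacobian. -/
lemma areaDensity_comp [IsManifold (𝓡 2) 1 M] {e c : OpenPartialHomeomorph M Plane}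
    (hc : c ∈ IsManifold.maximalAtlas (𝓡 2) 1 M) {τ : Plane → Plane} {y : Plane}
    (hτ : DifferentiableAt ℝ τ y) (hy : τ y ∈ c.target) (h : e.symm =ᶠ[𝓝 y] c.symm ∘ τ) :
    areaDensity e y = |(fderiv ℝ τ y).det| * areaDensity c (τ y) := by
  rw [areaDensity, areaDensity, ← areaFactor_comp]
  refine areaFactor_congr h.self_of_nhds fun v => ?_
  have h1 : mfderiv (𝓡 2) (𝓡 2) (c.symm ∘ τ) y =
      (mfderiv (𝓡 2) (𝓡 2) c.symm (τ y)).comp (mfderiv (𝓡 2) (𝓡 2) τ y) :=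
    mfderiv_comp y (mdifferentiableAt_symm_chart hc hy) hτ.mdifferentiableAt
  rw [mfderiv_eq_fderiv] at h1
  exact congrArg (fun L : Plane →L[ℝ] Plane => L v) (h.mfderiv_eq.trans h1)

end Frame

/-! ### The area measure in arbitrary charts -/

section AreaFormula

lemma measurableSet_source_inter {α β : Type*} [TopologicalSpace α] [MeasurableSpace α]
    [BorelSpace α] [TopologicalSpace β] [MeasurableSpace β] [BorelSpace β]
    (e : OpenPartialHomeomorph α β) {S : Set β} (hS : MeasurableSet S) :
    MeasurableSet (e.source ∩ e ⁻¹' S) := by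
  have h : Measurable (fun y : e.source => e y) :=
    (continuousOn_iff_continuous_domRestrict.1 e.continuousOn).measurable
  have := (e.open_source.measurableSet).subtype_image (h hS)
  convert this using 1
  ext y
  simp [and_comm]

lemma measurableSet_target_inter {α β : Type*} [TopologicalSpace α] [MeasurableSpace α]
    [BorelSpace α] [TopologicalSpace β] [MeasurableSpace β] [BorelSpace β]
    (e : OpenPartialHomeomorph α β) {S : Set α} (hS : MeasurableSet S) :
    MeasurableSet (e.target ∩ e.symm ⁻¹' S) :=
  measurableSet_source_inter e.symm hS

variable {M : Type*} [TopologicalSpace M] [ChartedSpace Plane M] [MeasurableSpace M] [BorelSpace M]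

variable [RiemannianBundle (fun x : M => TangentSpace (𝓡 2) x)]

/-- The measure `chartArea c` in terms of the density of the chart at `c`. -/
lemma chartArea_apply (c : M) {S : Set M} (hS : MeasurableSet S) :
    chartArea c S = ∫⁻ y in (chartAt Plane c).target ∩ (chartAt Plane c).symm ⁻¹' S,
      ENNReal.ofReal (areaDensity (chartAt Plane c) y) := by
  have hT : (extChartAt (𝓡 2) c).target = (chartAt Plane c).target := by
    simp
  have hf : ((extChartAt (𝓡 2) c).symm : Plane → M) = (chartAt Plane c).symm := by
    ext y
    rfl
  have hm : AEMeasurable (chartAt Plane c).symm (volume.restrict (chartAt Plane c).target) :=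
    (chartAt Plane c).continuousOn_symm.aemeasurable (chartAt Plane c).open_target.measurableSet
  rw [chartArea, chartDensity_eq, hT, hf,
    Measure.map_apply_of_aemeasurable (hm.mono_ac (withDensity_absolutelyContinuous _ _)) hS,
    withDensity_apply' _ _,
    Measure.restrict_restrict' (chartAt Plane c).open_target.measurableSet, inter_comm]

/-- The integral of the density over a set common to the domains of two charts is the same in both
charts, by the change of variables formula. -/
lemma lintegral_areaDensity_eq [IsManifold (𝓡 2) 1 M] {e c : OpenPartialHomeomorph M Plane}
    (he : e ∈ IsManifold.maximalAtlas (𝓡 2) 1 M) (hc : c ∈ IsManifold.maximalAtlas (𝓡 2) 1 M)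
    {S : Set M} (hS : MeasurableSet S) (hSe : S ⊆ e.source) (hSc : S ⊆ c.source) :
    ∫⁻ y in c.target ∩ c.symm ⁻¹' S, ENNReal.ofReal (areaDensity c y) =
      ∫⁻ y in e.target ∩ e.symm ⁻¹' S, ENNReal.ofReal (areaDensity e y) := by
  set τ : Plane → Plane := fun y => c (e.symm y) with hτ
  have himg : c.target ∩ c.symm ⁻¹' S = τ '' (e.target ∩ e.symm ⁻¹' S) := by
    ext y
    constructor
    · rintro ⟨hy, hyS⟩
      exact ⟨e (c.symm y), ⟨e.map_source (hSe hyS), by simpa [e.left_inv (hSe hyS)] using hyS⟩,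
        by simp [hτ, e.left_inv (hSe hyS), c.right_inv hy]⟩
    · rintro ⟨z, ⟨-, hzS⟩, rfl⟩
      exact ⟨c.map_source (hSc hzS), by simpa [hτ, c.left_inv (hSc hzS)] using hzS⟩
  have hdiff : ∀ y ∈ e.target ∩ e.symm ⁻¹' S, DifferentiableAt ℝ τ y := by
    rintro y ⟨hy, hyS⟩
    have h1 : MDifferentiableAt (𝓡 2) (𝓡 2) c (e.symm y) :=
      (contMDiffAt_of_mem_maximalAtlas hc (hSc hyS)).mdifferentiableAt one_ne_zero
    exact (h1.comp y (mdifferentiableAt_symm_chart he hy)).differentiableAt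
  have hinj : InjOn τ (e.target ∩ e.symm ⁻¹' S) := by
    rintro y ⟨hy, hyS⟩ z ⟨hz, hzS⟩ hyz
    exact e.symm.injOn hy hz (c.injOn (hSc hyS) (hSc hzS) hyz)
  rw [himg, lintegral_image_eq_lintegral_abs_det_fderiv_mul volume
    (measurableSet_target_inter e hS) (fun y hy => (hdiff y hy).hasFDerivAt.hasFDerivWithinAt) hinj]
  refine setLIntegral_congr_fun (measurableSet_target_inter e hS) fun y hy => ?_
  have hev : e.symm =ᶠ[𝓝 y] c.symm ∘ τ := by
    have : e.target ∩ e.symm ⁻¹' c.source ∈ 𝓝 y :=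
      (e.isOpen_inter_preimage_symm c.open_source).mem_nhds ⟨hy.1, hSc hy.2⟩
    filter_upwards [this] with z hz
    simp [hτ, c.left_inv hz.2]
  rw [areaDensity_comp hc (hdiff y hy) (c.map_source (hSc hy.2)) hev,
    ENNReal.ofReal_mul (abs_nonneg _)]

variable [CompactSpace M] [Nonempty M]

/-- The area of a set inside the domain of an arbitrary `C^1` chart. -/
theorem areaMeasure_apply [IsManifold (𝓡 2) 1 M] {e : OpenPartialHomeomorph M Plane}
    (he : e ∈ IsManifold.maximalAtlas (𝓡 2) 1 M) {S : Set M} (hS : MeasurableSet S)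
    (hSe : S ⊆ e.source) :
    areaMeasure M S = ∫⁻ y in e.target ∩ e.symm ⁻¹' S, ENNReal.ofReal (areaDensity e y) := by
  set D : ℕ → Set M := disjointed (fun k => (chartAt Plane (chartCenter M k)).source) with hD
  have hDm : ∀ n, MeasurableSet (D n) := fun n =>
    MeasurableSet.disjointed (fun k => (chartAt Plane (chartCenter M k)).open_source.measurableSet) n
  have hDU : ⋃ n, D n = univ := by
    rw [hD, iUnion_disjointed]
    exact (exists_chart_cover M).choose_spec
  have hDs : ∀ n, D n ⊆ (chartAt Plane (chartCenter M n)).source := fun n =>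
    disjointed_le (fun k => (chartAt Plane (chartCenter M k)).source) n
  have hterm : ∀ n, (chartArea (chartCenter M n)).restrict (D n) S =
      ∫⁻ y in e.target ∩ e.symm ⁻¹' (S ∩ D n), ENNReal.ofReal (areaDensity e y) := by
    intro n
    rw [Measure.restrict_apply hS, chartArea_apply _ (hS.inter (hDm n))]
    exact lintegral_areaDensity_eq he (IsManifold.chart_mem_maximalAtlas _) (hS.inter (hDm n))
      (inter_subset_left.trans hSe) (inter_subset_right.trans (hDs n))
  have hU : e.target ∩ e.symm ⁻¹' S = ⋃ n, e.target ∩ e.symm ⁻¹' (S ∩ D n) := by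
    rw [← inter_iUnion, ← preimage_iUnion, ← inter_iUnion, hDU, inter_univ]
  rw [areaMeasure, Measure.sum_apply _ hS, tsum_congr hterm, hU,
    lintegral_iUnion (fun n => measurableSet_target_inter e (hS.inter (hDm n)))]
  intro m n hmn
  refine Disjoint.mono inter_subset_right inter_subset_right (Disjoint.preimage _ ?_)
  exact (disjoint_disjointed _ hmn).mono inter_subset_right inter_subset_right

lemma areaMeasure_apply_of_areaDensity_eq_one [IsManifold (𝓡 2) 1 M]
    {e : OpenPartialHomeomorph M Plane}
    (he : e ∈ IsManifold.maximalAtlas (𝓡 2) 1 M) (he1 : ∀ y ∈ e.target, areaDensity e y = 1)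
    {S : Set M} (hS : MeasurableSet S) (hSe : S ⊆ e.source) :
    areaMeasure M S = volume (e.target ∩ e.symm ⁻¹' S) := by
  rw [areaMeasure_apply he hS hSe, setLIntegral_congr_fun (measurableSet_target_inter e hS)
    (g := fun _ => 1) (fun y hy => by simp [he1 y hy.1]), setLIntegral_one]

end AreaFormula

/-! ### Diffeomorphisms that preserve area -/

section TangentParametrization

variable {M : Type*} [TopologicalSpace M] [ChartedSpace Plane M] [IsManifold (𝓡 2) 1 M]

/-- The parametrization of the tangent bundle induced by a chart of the surface. -/
def tangentParam (e : OpenPartialHomeomorph M Plane) (q : Plane × Plane) :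
    TangentBundle (𝓡 2) M :=
  ⟨e.symm q.1, chartFrame e q.1 q.2⟩

lemma tangentParam_eq {e : OpenPartialHomeomorph M Plane}
    (he : e ∈ IsManifold.maximalAtlas (𝓡 2) 1 M) {q : Plane × Plane} (hq : q.1 ∈ e.target) :
    tangentParam e q = tangentMapWithin (𝓡 2) (𝓡 2) e.symm e.target
      ((tangentBundleModelSpaceHomeomorph (𝓡 2)).symm q) := by
  rw [tangentMapWithin_eq_tangentMap (e.open_target.uniqueMDiffOn _ hq)
    (mdifferentiableAt_symm_chart he hq)]
  rfl

lemma continuousOn_tangentParam {e : OpenPartialHomeomorph M Plane}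
    (he : e ∈ IsManifold.maximalAtlas (𝓡 2) 1 M) :
    ContinuousOn (tangentParam e) (e.target ×ˢ univ) := by
  have h := (contMDiffOn_symm_of_mem_maximalAtlas he).continuousOn_tangentMapWithin le_rfl
    e.open_target.uniqueMDiffOn
  have h2 := h.comp (s := e.target ×ˢ univ)
    (tangentBundleModelSpaceHomeomorph (𝓡 2)).symm.continuous.continuousOn (fun q hq => hq.1)
  exact h2.congr fun q hq => tangentParam_eq he hq.1

lemma contMDiffOn_tangentParam {e : OpenPartialHomeomorph M Plane}
    (he : e ∈ IsManifold.maximalAtlas (𝓡 2) 1 M)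
    (he' : ContMDiffOn (𝓡 2) (𝓡 2) 2 e.symm e.target) (v : Plane) :
    ContMDiffOn (𝓡 2) (𝓡 2).tangent 1 (fun z => tangentParam e (z, v)) e.target := by
  have h := he'.contMDiffOn_tangentMapWithin (m := 1) (by norm_num [one_add_one_eq_two])
    e.open_target.uniqueMDiffOn
  have h1 : ContMDiff (𝓡 2) ((𝓡 2).prod 𝓘(ℝ, Plane)) 1
      (fun z : Plane => ((z, v) : Plane × Plane)) :=
    contMDiff_id.prodMk contMDiff_const
  rw [chartedSpaceSelf_prod] at h1
  have h2 : ContMDiff (𝓡 2) (𝓡 2).tangent 1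
      (fun z : Plane => (tangentBundleModelSpaceHomeomorph (𝓡 2)).symm (z, v)) :=
    contMDiff_tangentBundleModelSpaceHomeomorph_symm.comp h1
  have h3 := h.comp (s := e.target) h2.contMDiffOn (fun q hq => hq)
  exact h3.congr fun q hq => tangentParam_eq he hq

variable [RiemannianBundle (fun x : M => TangentSpace (𝓡 2) x)]

lemma continuousOn_areaDensity
    [IsContinuousRiemannianBundle Plane (fun x : M => TangentSpace (𝓡 2) x)]
    {e : OpenPartialHomeomorph M Plane} (he : e ∈ IsManifold.maximalAtlas (𝓡 2) 1 M) :
    ContinuousOn (areaDensity e) e.target := by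
  have h : ∀ v : Plane, ContinuousOn (fun z => tangentParam e (z, v)) e.target := fun v =>
    (continuousOn_tangentParam he).comp (by fun_prop) (fun z hz => ⟨hz, mem_univ _⟩)
  have hi : ∀ v w : Plane,
      ContinuousOn (fun z => inner ℝ (chartFrame e z v) (chartFrame e z w)) e.target :=
    fun v w => (h v).inner_bundle (h w)
  unfold areaDensity areaFactor parallelogramArea
  simp only [← real_inner_self_eq_norm_sq]
  exact (((hi _ _).mul (hi _ _)).sub ((hi _ _).pow 2)).sqrt

lemma contDiffOn_areaDensity
    [IsContMDiffRiemannianBundle (𝓡 2) 1 Plane (fun x : M => TangentSpace (𝓡 2) x)]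
    {e : OpenPartialHomeomorph M Plane} (he : e ∈ IsManifold.maximalAtlas (𝓡 2) 1 M)
    (he' : ContMDiffOn (𝓡 2) (𝓡 2) 2 e.symm e.target) :
    ContDiffOn ℝ 1 (areaDensity e) e.target := by
  have h := fun v : Plane => contMDiffOn_tangentParam he he' v
  have hi : ∀ v w : Plane,
      ContDiffOn ℝ 1 (fun z => inner ℝ (chartFrame e z v) (chartFrame e z w)) e.target :=
    fun v w => ((h v).inner_bundle (h w)).contDiffOn
  unfold areaDensity areaFactor parallelogramArea
  simp only [← real_inner_self_eq_norm_sq]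
  refine (((hi _ _).mul (hi _ _)).sub ((hi _ _).pow 2)).sqrt fun z hz h0 => ?_
  have h1 := areaDensity_pos he hz
  unfold areaDensity areaFactor parallelogramArea at h1
  simp only [← real_inner_self_eq_norm_sq] at h1
  rw [h0, Real.sqrt_zero] at h1
  exact h1.false

end TangentParametrization

section PreservesArea

variable {M : Type*} [TopologicalSpace M] [ChartedSpace Plane M]

/-- The chart obtained by transporting the chart `e` by the diffeomorphism `g`; the corresponding
parametrization is `g ∘ e.symm`. -/
def pushChart (g : Diff1 M) (e : OpenPartialHomeomorph M Plane) : OpenPartialHomeomorph M Plane :=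
  g.symm.toHomeomorph.toOpenPartialHomeomorph.trans e

lemma pushChart_source (g : Diff1 M) (e : OpenPartialHomeomorph M Plane) :
    (pushChart g e).source = g.symm ⁻¹' e.source := by
  simp [pushChart]

lemma pushChart_target (g : Diff1 M) (e : OpenPartialHomeomorph M Plane) :
    (pushChart g e).target = e.target := by
  simp [pushChart]

lemma pushChart_symm (g : Diff1 M) (e : OpenPartialHomeomorph M Plane) (y : Plane) :
    (pushChart g e).symm y = g (e.symm y) := by
  simp [pushChart]

variable [IsManifold (𝓡 2) 1 M]

lemma pushChart_mem_maximalAtlas (g : Diff1 M) {e : OpenPartialHomeomorph M Plane}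
    (he : e ∈ IsManifold.maximalAtlas (𝓡 2) 1 M) :
    pushChart g e ∈ IsManifold.maximalAtlas (𝓡 2) 1 M := by
  rw [IsManifold.mem_maximalAtlas_iff_contMDiffOn]
  constructor
  · rw [pushChart_source]
    exact (contMDiffOn_of_mem_maximalAtlas he).comp g.symm.contMDiff.contMDiffOn
      (subset_refl _)
  · rw [pushChart_target]
    exact (g.contMDiff.comp_contMDiffOn (contMDiffOn_symm_of_mem_maximalAtlas he)).congr
      fun y _ => pushChart_symm g e y

variable [RiemannianBundle (fun x : M => TangentSpace (𝓡 2) x)]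

lemma areaDensity_pushChart (g : Diff1 M) {e : OpenPartialHomeomorph M Plane}
    (he : e ∈ IsManifold.maximalAtlas (𝓡 2) 1 M) {y : Plane} (hy : y ∈ e.target) :
    areaDensity (pushChart g e) y =
      areaFactor (ContinuousLinearMap.comp (mfderiv (𝓡 2) (𝓡 2) g (e.symm y))
        (chartFrame e y)) := by
  refine areaFactor_congr (pushChart_symm g e y) fun v => ?_
  have h1 : mfderiv (𝓡 2) (𝓡 2) (g ∘ e.symm) y =
      (mfderiv (𝓡 2) (𝓡 2) g (e.symm y)).comp (mfderiv (𝓡 2) (𝓡 2) e.symm y) :=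
    mfderiv_comp y (g.mdifferentiable one_ne_zero _) (mdifferentiableAt_symm_chart he hy)
  have h3 : (pushChart g e).symm =ᶠ[𝓝 y] g ∘ e.symm := Filter.Eventually.of_forall
    fun z => pushChart_symm g e z
  exact congrArg (fun L : Plane →L[ℝ] Plane => L v) (h3.mfderiv_eq.trans h1)

/-- A diffeomorphism that does not change the density at a point preserves area infinitesimally. -/
lemma preservesArea_of_areaDensity_eq {g : Diff1 M}
    {e : OpenPartialHomeomorph M Plane}
    (he : e ∈ IsManifold.maximalAtlas (𝓡 2) 1 M) {x : M} (hx : x ∈ e.source)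
    (h : areaDensity (pushChart g e) (e x) = areaDensity e (e x)) :
    PreservesArea (mfderiv (𝓡 2) (𝓡 2) g x) := by
  rw [areaDensity_pushChart g he (e.map_source hx)] at h
  have hres : PreservesArea (mfderiv (𝓡 2) (𝓡 2) g (e.symm (e x))) :=
    preservesArea_of_areaFactor_comp (chartFrame_bijective he (e.map_source hx)).2 h
  rwa [e.left_inv hx] at hres

variable [MeasurableSpace M] [BorelSpace M] [CompactSpace M] [Nonempty M]

/-- The area of `S` and that of its image by `g` are the integrals over the same set of the two
densities of the charts `e` and `pushChart g e`. -/
lemma areaMeasure_preimage_symm (g : Diff1 M) {e : OpenPartialHomeomorph M Plane}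
    (he : e ∈ IsManifold.maximalAtlas (𝓡 2) 1 M) {S : Set M} (hS : MeasurableSet S)
    (hSe : S ⊆ e.source) :
    areaMeasure M (g.symm ⁻¹' S) =
      ∫⁻ y in e.target ∩ e.symm ⁻¹' S, ENNReal.ofReal (areaDensity (pushChart g e) y) := by
  rw [areaMeasure_apply (pushChart_mem_maximalAtlas g he) (g.symm.continuous.measurable hS)
    (by rw [pushChart_source]; exact preimage_mono hSe), pushChart_target]
  congr 2
  ext y
  simp [pushChart_symm]

/-- A `C^1` diffeomorphism whose derivative preserves area at every point preserves the area
measure. -/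
theorem measurePreserving_of_preservesArea (g : Diff1 M)
    (hg : ∀ x, PreservesArea (mfderiv (𝓡 2) (𝓡 2) g x)) :
    MeasurePreserving g (areaMeasure M) (areaMeasure M) := by
  have key : Measure.map g.symm (areaMeasure M) = areaMeasure M := by
    rw [Measure.ext_iff_of_iUnion_eq_univ (exists_chart_cover M).choose_spec]
    intro n
    ext S hS
    set e := chartAt Plane (chartCenter M n)
    have he : e ∈ IsManifold.maximalAtlas (𝓡 2) 1 M := IsManifold.chart_mem_maximalAtlas _
    have hSe : MeasurableSet (S ∩ e.source) := hS.inter e.open_source.measurableSet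
    rw [Measure.restrict_apply hS, Measure.restrict_apply hS]
    change Measure.map g.symm (areaMeasure M) (S ∩ e.source) = areaMeasure M (S ∩ e.source)
    rw [Measure.map_apply g.symm.continuous.measurable hSe,
      areaMeasure_preimage_symm g he hSe inter_subset_right,
      areaMeasure_apply he hSe inter_subset_right]
    refine setLIntegral_congr_fun (measurableSet_target_inter e hSe) fun y hy => ?_
    rw [areaDensity_pushChart g he hy.1, (hg _).areaFactor_comp]
    rfl
  refine ⟨g.continuous.measurable, ?_⟩
  conv_lhs => rw [← key]
  rw [Measure.map_map g.continuous.measurable g.symm.continuous.measurable]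
  have : (g ∘ g.symm : M → M) = id := funext g.apply_symm_apply
  rw [this, Measure.map_id]

/-- A `C^1` diffeomorphism that preserves the area measure has a derivative that preserves area at
every point: the densities of the charts `e` and `pushChart g e` have the same integrals, and they
are continuous. -/
theorem preservesArea_of_measurePreserving
    [IsContinuousRiemannianBundle Plane (fun x : M => TangentSpace (𝓡 2) x)] (g : Diff1 M)
    (hg : MeasurePreserving g (areaMeasure M) (areaMeasure M)) (x : M) :
    PreservesArea (mfderiv (𝓡 2) (𝓡 2) g x) := by
  set e := chartAt Plane x
  have he : e ∈ IsManifold.maximalAtlas (𝓡 2) 1 M := IsManifold.chart_mem_maximalAtlas _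
  have hge := pushChart_mem_maximalAtlas g he
  have hc1 := continuousOn_areaDensity he
  have hc2 := continuousOn_areaDensity hge
  rw [pushChart_target] at hc2
  have hTm := e.open_target.measurableSet
  have hae : (fun y => ENNReal.ofReal (areaDensity (pushChart g e) y))
      =ᵐ[volume.restrict e.target] fun y => ENNReal.ofReal (areaDensity e y) := by
    refine ae_eq_of_forall_setLIntegral_eq_of_sigmaFinite₀ (hc2.aemeasurable hTm).ennreal_ofReal
      (hc1.aemeasurable hTm).ennreal_ofReal fun B hB _ => ?_
    rw [Measure.restrict_restrict hB]
    set S : Set M := e.source ∩ e ⁻¹' B with hSdef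
    have hS : MeasurableSet S := measurableSet_source_inter e hB
    have hBS : B ∩ e.target = e.target ∩ e.symm ⁻¹' S := by
      ext y
      constructor
      · rintro ⟨hyB, hy⟩
        exact ⟨hy, e.map_target hy, by simpa [e.right_inv hy] using hyB⟩
      · rintro ⟨hy, -, hyB⟩
        exact ⟨by simpa [e.right_inv hy] using hyB, hy⟩
    rw [hBS, ← areaMeasure_preimage_symm g he hS inter_subset_left,
      ← areaMeasure_apply he hS inter_subset_left]
    have hgS := hg.measure_preimage (g.symm.continuous.measurable hS).nullMeasurableSet
    rw [← hgS, ← preimage_comp]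
    have : (g.symm ∘ g : M → M) = id := funext g.symm_apply_apply
    rw [this, preimage_id]
  have heq := Measure.eqOn_open_of_ae_eq hae e.open_target
    (ENNReal.continuous_ofReal.comp_continuousOn hc2)
    (ENNReal.continuous_ofReal.comp_continuousOn hc1)
  have hx : e x ∈ e.target := mem_chart_target Plane x
  have hval : areaDensity (pushChart g e) (e x) = areaDensity e (e x) := by
    have := heq hx
    rwa [ENNReal.ofReal_eq_ofReal_iff] at this
    · exact (areaDensity_pos hge (by rwa [pushChart_target])).le
    · exact (areaDensity_pos he hx).le
  exact preservesArea_of_areaDensity_eq he (mem_chart_source Plane x) hval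

end PreservesArea

/-! ### Charts in which the area is the Lebesgue measure -/

section Straightening

lemma contDiff_one_intervalIntegral {E : Type*} [NormedAddCommGroup E] [NormedSpace ℝ E]
    [ProperSpace E] {φ : E × ℝ → ℝ} (hφ : ContDiff ℝ 1 φ) :
    ContDiff ℝ 1 (fun z => ∫ t in (0 : ℝ)..1, φ (z, t)) := by
  have hd : Continuous (fderiv ℝ φ) := hφ.continuous_fderiv one_ne_zero
  set φ' : E → ℝ → E →L[ℝ] ℝ := fun z t =>
    (fderiv ℝ φ (z, t)).comp (ContinuousLinearMap.inl ℝ E ℝ) with hφ'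
  have hφ'c : Continuous (Function.uncurry φ') := by
    have : Continuous fun p : E × ℝ =>
        (fderiv ℝ φ p).comp (ContinuousLinearMap.inl ℝ E ℝ) := by fun_prop
    exact this
  rw [contDiff_one_iff_hasFDerivAt]
  refine ⟨fun z => ∫ t in (0 : ℝ)..1, φ' z t,
    intervalIntegral.continuous_parametric_intervalIntegral_of_continuous' hφ'c 0 1, fun z₀ => ?_⟩
  have hK : IsCompact (Metric.closedBall z₀ 1 ×ˢ Icc (0 : ℝ) 1) :=
    (isCompact_closedBall z₀ 1).prod isCompact_Icc
  obtain ⟨C, hC⟩ := hK.exists_bound_of_continuousOn hφ'c.continuousOn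
  refine intervalIntegral.hasFDerivAt_integral_of_dominated_of_fderiv_le
    (F := fun z t => φ (z, t)) (F' := φ') (bound := fun _ => C)
    (Metric.ball_mem_nhds z₀ one_pos) ?_ ?_ ?_ ?_ ?_ ?_
  · refine Filter.Eventually.of_forall fun z => ?_
    exact (hφ.continuous.comp (by fun_prop : Continuous fun t : ℝ => (z, t))).aestronglyMeasurable
  · exact (hφ.continuous.comp
      (by fun_prop : Continuous fun t : ℝ => (z₀, t))).intervalIntegrable _ _
  · exact (hφ'c.comp (by fun_prop : Continuous fun t : ℝ => (z₀, t))).aestronglyMeasurable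
  · refine Filter.Eventually.of_forall fun t ht z hz => ?_
    rw [uIoc_of_le zero_le_one] at ht
    exact hC (z, t) ⟨Metric.ball_subset_closedBall hz, ht.1.le, ht.2⟩
  · exact intervalIntegrable_const
  · refine Filter.Eventually.of_forall fun t _ z _ => ?_
    have h1 : HasFDerivAt φ (fderiv ℝ φ (z, t)) (z, t) :=
      (hφ.differentiable one_ne_zero _).hasFDerivAt
    exact h1.comp z (hasFDerivAt_prodMk_left z t)

/-- A `C^1` density on the plane has a `C^1` primitive in the direction of the first coordinate. -/
lemma exists_primitive {ρ : Plane → ℝ} (hρ : ContDiff ℝ 1 ρ) (y₀ : Plane) :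
    ∃ F : Plane → ℝ, ContDiff ℝ 1 F ∧ F y₀ = 0 ∧ ∀ y, fderiv ℝ F y e₀ = ρ y := by
  set a := y₀ 0 with ha
  -- on the segment from `(a, y 1)` to `y`, parametrized by `[0, 1]`
  set G : Plane → ℝ := fun y => ∫ t in (0 : ℝ)..1, ρ ((a + t * (y 0 - a)) • e₀ + y 1 • e₁)
    with hG
  have hGc : ContDiff ℝ 1 G := by
    have h0 : ContDiff ℝ 1 fun p : Plane × ℝ =>
        ρ ((a + p.2 * (p.1 0 - a)) • e₀ + p.1 1 • e₁) := by
      refine hρ.comp ?_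
      fun_prop
    exact contDiff_one_intervalIntegral h0
  have hF : ContDiff ℝ 1 fun y : Plane => (y 0 - a) * G y := by
    refine ContDiff.mul ?_ hGc
    fun_prop
  refine ⟨fun y => (y 0 - a) * G y, hF, by simp [ha], fun y => ?_⟩
  have hline : ∀ s : ℝ, ((y + s • e₀) 0 - a) * G (y + s • e₀) =
      ∫ u in a..(y 0 + s), ρ (u • e₀ + y 1 • e₁) := by
    intro s
    have := intervalIntegral.smul_integral_comp_add_mul (a := 0) (b := 1)
      (fun u => ρ (u • e₀ + y 1 • e₁)) (y 0 + s - a) a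
    simp only [mul_zero, add_zero, mul_one, smul_eq_mul] at this
    rw [show a + (y 0 + s - a) = y 0 + s by ring] at this
    rw [← this]
    simp only [hG]
    congr 1
    · simp
    · refine intervalIntegral.integral_congr fun t _ => ?_
      simp [mul_comm]
  have hc : Continuous fun u : ℝ => ρ (u • e₀ + y 1 • e₁) :=
    hρ.continuous.comp (by fun_prop)
  have h1 : HasDerivAt (fun s : ℝ => ∫ u in a..(y 0 + s), ρ (u • e₀ + y 1 • e₁)) (ρ y) 0 := by
    have h2 := intervalIntegral.integral_hasDerivAt_right (hc.intervalIntegrable a (y 0 + 0))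
      hc.aestronglyMeasurable.stronglyMeasurableAtFilter hc.continuousAt
    have h3 := h2.comp (0 : ℝ) ((hasDerivAt_id (0 : ℝ)).const_add (y 0))
    simp only [add_zero, mul_one, ← plane_eq] at h3
    exact h3
  have h4 : HasDerivAt (fun s : ℝ => ((y + s • e₀) 0 - a) * G (y + s • e₀))
      (fderiv ℝ (fun y : Plane => (y 0 - a) * G y) y e₀) 0 := by
    have hl : HasDerivAt (fun s : ℝ => y + s • e₀) e₀ 0 := by
      simpa using ((hasDerivAt_id (0 : ℝ)).smul_const e₀).const_add y
    have hd : HasFDerivAt (fun y : Plane => (y 0 - a) * G y)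
        (fderiv ℝ (fun y : Plane => (y 0 - a) * G y) y) (y + (0 : ℝ) • e₀) := by
      simpa using (hF.differentiable one_ne_zero y).hasFDerivAt
    exact hd.comp_hasDerivAt (0 : ℝ) hl
  rw [funext hline] at h4
  exact h4.unique h1

/-- A positive `C^1` density on the plane is locally the Jacobian of a `C^1` change of coordinates.
-/
lemma exists_chart_det_eq {ρ : Plane → ℝ} {T : Set Plane} (hT : IsOpen T)
    (hρ : ContDiffOn ℝ 1 ρ T) (hpos : ∀ y ∈ T, 0 < ρ y) {y₀ : Plane} (hy₀ : y₀ ∈ T) :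
    ∃ ψ : OpenPartialHomeomorph Plane Plane, y₀ ∈ ψ.source ∧ ψ.source ⊆ T ∧ ψ y₀ = 0 ∧
      ContDiffOn ℝ 1 ψ ψ.source ∧ ContDiffOn ℝ 1 ψ.symm ψ.target ∧
      ∀ y ∈ ψ.source, |(fderiv ℝ ψ y).det| = ρ y := by
  -- cut off the density to make it globally defined
  obtain ⟨r, hr, hrT⟩ := Metric.isOpen_iff.1 hT y₀ hy₀
  let χ : ContDiffBump y₀ := ⟨r / 4, r / 2, by positivity, by linarith⟩
  have hχT : tsupport χ ⊆ T := by
    rw [χ.tsupport_eq]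
    exact (Metric.closedBall_subset_ball (by change r / 2 < r; linarith)).trans hrT
  have hρ' : ContDiff ℝ 1 fun y => χ y * ρ y := by
    rw [contDiff_iff_contDiffAt]
    intro y
    by_cases hy : y ∈ tsupport χ
    · exact χ.contDiffAt.mul (hρ.contDiffAt (hT.mem_nhds (hχT hy)))
    · have : (fun y => χ y * ρ y) =ᶠ[𝓝 y] fun _ => 0 := by
        filter_upwards [(isClosed_tsupport χ).isOpen_compl.mem_nhds hy] with z hz
        rw [image_eq_zero_of_notMem_tsupport hz, zero_mul]
      exact contDiffAt_const.congr_of_eventuallyEq this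
  obtain ⟨F, hF, hF0, hFe⟩ := exists_primitive hρ' y₀
  set Ψ : Plane → Plane := fun y => F y • e₀ + (y 1 - y₀ 1) • e₁ with hΨ
  have hΨc : ContDiff ℝ 1 Ψ := by
    refine (hF.smul contDiff_const).add ?_
    fun_prop
  have hder : ∀ y v, fderiv ℝ Ψ y v = (fderiv ℝ F y v) • e₀ + v 1 • e₁ := by
    intro y v
    have h1 : HasFDerivAt F (fderiv ℝ F y) y := (hF.differentiable one_ne_zero y).hasFDerivAt
    have h2 : HasFDerivAt (fun y : Plane => y 1 - y₀ 1)
        (EuclideanSpace.proj 1 : Plane →L[ℝ] ℝ) y :=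
      (EuclideanSpace.proj 1 : Plane →L[ℝ] ℝ).hasFDerivAt.sub_const _
    have h3 := (h1.smul_const e₀).add (h2.smul_const e₁)
    rw [show fderiv ℝ Ψ y = _ from h3.fderiv]
    simp
  have hdet : ∀ y, (fderiv ℝ Ψ y).det = χ y * ρ y := by
    intro y
    rw [det_plane, hder, hder, hFe]
    simp
  have hball : ∀ y ∈ Metric.ball y₀ (r / 4), χ y = 1 := fun y hy =>
    χ.one_of_mem_closedBall (Metric.ball_subset_closedBall hy)
  have hne : ∀ y ∈ Metric.ball y₀ (r / 4), (fderiv ℝ Ψ y).det ≠ 0 := by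
    intro y hy
    rw [hdet, hball y hy, one_mul]
    exact (hpos y (hrT (Metric.ball_subset_ball (by linarith) hy))).ne'
  have hy₀b : y₀ ∈ Metric.ball y₀ (r / 4) := Metric.mem_ball_self (by positivity)
  have hΨd : ∀ y (hy : y ∈ Metric.ball y₀ (r / 4)), HasFDerivAt Ψ
      (((fderiv ℝ Ψ y).toContinuousLinearEquivOfDetNeZero (hne y hy) : Plane ≃L[ℝ] Plane) :
        Plane →L[ℝ] Plane) y := by
    intro y hy
    rw [ContinuousLinearMap.coe_toContinuousLinearEquivOfDetNeZero]
    exact (hΨc.differentiable one_ne_zero y).hasFDerivAt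
  set ψ₀ := hΨc.contDiffAt.toOpenPartialHomeomorph Ψ (hΨd y₀ hy₀b) one_ne_zero with hψ₀
  set ψ := ψ₀.restrOpen _ (Metric.isOpen_ball (x := y₀) (ε := r / 4)) with hψ
  have hcoe : (ψ : Plane → Plane) = Ψ := by
    simp [hψ, hψ₀]
  have hsrc : ψ.source = ψ₀.source ∩ Metric.ball y₀ (r / 4) := by
    simp [hψ]
  refine ⟨ψ, ?_, ?_, ?_, ?_, ?_, ?_⟩
  · rw [hsrc]
    exact ⟨hΨc.contDiffAt.mem_toOpenPartialHomeomorph_source (hΨd y₀ hy₀b) one_ne_zero, hy₀b⟩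
  · rw [hsrc]
    exact inter_subset_right.trans ((Metric.ball_subset_ball (by linarith)).trans hrT)
  · rw [hcoe]
    simp [hΨ, hF0]
  · rw [hcoe]
    exact hΨc.contDiffOn
  · intro z hz
    have hz' := ψ.map_target hz
    rw [hsrc] at hz'
    refine (ψ.contDiffAt_symm hz (f₀' := (fderiv ℝ Ψ (ψ.symm z)).toContinuousLinearEquivOfDetNeZero
      (hne _ hz'.2)) ?_ ?_).contDiffWithinAt
    · rw [hcoe]
      exact hΨd _ hz'.2
    · rw [hcoe]
      exact hΨc.contDiffAt
  · intro y hy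
    rw [hsrc] at hy
    rw [hcoe, hdet, hball y hy.2, one_mul]
    exact abs_of_pos (hpos y (hrT (Metric.ball_subset_ball (by linarith) hy.2)))

end Straightening

section AreaChart

variable {M : Type*} [TopologicalSpace M] [ChartedSpace Plane M]
  [RiemannianBundle (fun x : M => TangentSpace (𝓡 2) x)]

/-- Every point is the origin of a `C^1` chart in which the area is the Lebesgue measure. -/
theorem exists_areaChart [IsManifold (𝓡 2) ∞ M]
    [IsContMDiffRiemannianBundle (𝓡 2) 1 Plane (fun x : M => TangentSpace (𝓡 2) x)] (x : M) :
    ∃ e : OpenPartialHomeomorph M Plane, e ∈ IsManifold.maximalAtlas (𝓡 2) 1 M ∧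
      x ∈ e.source ∧ e x = 0 ∧ ∀ y ∈ e.target, areaDensity e y = 1 := by
  set c := chartAt Plane x
  have hc : c ∈ IsManifold.maximalAtlas (𝓡 2) 1 M := IsManifold.chart_mem_maximalAtlas _
  have hc2 : ContMDiffOn (𝓡 2) (𝓡 2) 2 c.symm c.target :=
    (contMDiffOn_chart_symm (n := ∞)).of_le (WithTop.coe_le_coe.2 (le_top : (2 : ℕ∞) ≤ ⊤))
  obtain ⟨ψ, hxψ, hψT, hψ0, hψc, hψc', hdet⟩ := exists_chart_det_eq c.open_target
    (contDiffOn_areaDensity hc hc2) (fun y hy => areaDensity_pos hc hy) (mem_chart_target Plane x)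
  have hmem : c.trans ψ ∈ IsManifold.maximalAtlas (𝓡 2) 1 M := by
    rw [IsManifold.mem_maximalAtlas_iff_contMDiffOn]
    constructor
    · refine ContMDiffOn.comp (g := ψ) (f := c) (t := ψ.source) hψc.contMDiffOn
        ((contMDiffOn_of_mem_maximalAtlas hc).mono ?_) ?_
      · simp
      · simp
    · refine ContMDiffOn.comp (g := c.symm) (f := ψ.symm) (t := c.target)
        (contMDiffOn_symm_of_mem_maximalAtlas hc)
        (hψc'.contMDiffOn.mono ?_) ?_
      · simp
      · simp
  refine ⟨c.trans ψ, hmem, ?_, by simpa using hψ0, fun z hz => ?_⟩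
  · simpa [c] using hxψ
  · have hz1 : z ∈ ψ.target := by
      rw [OpenPartialHomeomorph.trans_target] at hz
      exact hz.1
    have hy := ψ.map_target hz1
    set y := ψ.symm z with hyz
    have hzy : ψ y = z := ψ.right_inv hz1
    have hd : DifferentiableAt ℝ ψ y :=
      (hψc.contDiffAt (ψ.open_source.mem_nhds hy)).differentiableAt one_ne_zero
    have h := areaDensity_comp (e := c) hmem hd (by rwa [hzy]) (by
      filter_upwards [ψ.open_source.mem_nhds hy] with w hw
      simp [ψ.left_inv hw])
    rw [hdet y hy, hzy] at h
    have hp := areaDensity_pos hc (hψT hy)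
    exact mul_left_cancel₀ hp.ne' (by rw [← h, mul_one])

end AreaChart

/-! ### Twist maps of the plane -/

section Cutoff

/-- A smooth cutoff function on the half-line, equal to `1` at `0` and vanishing on `[1, ∞)`. -/
def cutoff (s : ℝ) : ℝ := Real.smoothTransition (1 - s)

lemma contDiff_cutoff : ContDiff ℝ 1 cutoff :=
  Real.smoothTransition.contDiff.comp (contDiff_const.sub contDiff_id)

lemma cutoff_zero : cutoff 0 = 1 := by simp [cutoff]

lemma cutoff_of_one_le {s : ℝ} (hs : 1 ≤ s) : cutoff s = 0 :=
  Real.smoothTransition.zero_of_nonpos (by linarith)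

lemma abs_cutoff_le (s : ℝ) : |cutoff s| ≤ 1 := by
  rw [cutoff, abs_of_nonneg (Real.smoothTransition.nonneg _)]
  exact Real.smoothTransition.le_one _

/-- A bound on the logarithmic derivative: it makes the `C^1` size of the twist maps independent of
the size of their support. -/
lemma exists_cutoff_bound : ∃ C : ℝ, 0 ≤ C ∧ ∀ s, 0 ≤ s → |deriv cutoff s| * s ≤ C := by
  have hc : Continuous (deriv cutoff) := contDiff_cutoff.continuous_deriv le_rfl
  obtain ⟨C, hC⟩ := isCompact_Icc.exists_bound_of_continuousOn (s := Icc (0 : ℝ) 1) hc.continuousOn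
  have hC0 : 0 ≤ C := (norm_nonneg _).trans (hC 0 ⟨le_rfl, zero_le_one⟩)
  refine ⟨C, hC0, fun s hs => ?_⟩
  rcases le_or_gt s 1 with h | h
  · exact (mul_le_of_le_one_right (abs_nonneg _) h).trans (hC s ⟨hs, h⟩)
  · have : cutoff =ᶠ[𝓝 s] fun _ => 0 := by
      filter_upwards [lt_mem_nhds h] with u hu using cutoff_of_one_le hu.le
    rw [this.deriv_eq]
    simpa using hC0

end Cutoff

section Twist

/-- The rotation `cos t + sin t N` of angle `t` for the complex structure `N` (`N ∘ N = -1`). -/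
def rot (N : Plane →L[ℝ] Plane) (t : ℝ) : Plane →L[ℝ] Plane :=
  Real.cos t • ContinuousLinearMap.id ℝ Plane + Real.sin t • N

lemma rot_apply (N : Plane →L[ℝ] Plane) (t : ℝ) (z : Plane) :
    rot N t z = Real.cos t • z + Real.sin t • N z := rfl

lemma rot_rot_neg {N : Plane →L[ℝ] Plane} (hN : ∀ z, N (N z) = -z) (t : ℝ) (z : Plane) :
    rot N t (rot N (-t) z) = z := by
  simp only [rot_apply, Real.cos_neg, Real.sin_neg, map_add, map_smul, hN]
  have h := Real.cos_sq_add_sin_sq t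
  calc _ = (Real.cos t ^ 2 + Real.sin t ^ 2) • z := by module
    _ = z := by rw [h, one_smul]

/-- A positive quadratic form invariant by the rotations of the complex structure `N`. -/
def quad (N : Plane →L[ℝ] Plane) (z : Plane) : ℝ := ‖z‖ ^ 2 + ‖N z‖ ^ 2

lemma quad_rot {N : Plane →L[ℝ] Plane} (hN : ∀ z, N (N z) = -z) (t : ℝ) (z : Plane) :
    quad N (rot N t z) = quad N z := by
  simp only [quad, rot_apply, map_add, map_smul, hN, ← real_inner_self_eq_norm_sq,
    inner_add_left, inner_add_right, inner_smul_left, inner_smul_right, inner_neg_left,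
    inner_neg_right, real_inner_comm z (N z), RCLike.conj_to_real]
  have h := Real.cos_sq_add_sin_sq t
  linear_combination (inner ℝ z z + inner ℝ (N z) (N z)) * h

lemma hasFDerivAt_quad (N : Plane →L[ℝ] Plane) (z : Plane) :
    HasFDerivAt (quad N) (2 • innerSL ℝ z + 2 • (innerSL ℝ (N z)).comp N) z := by
  have h1 := (hasStrictFDerivAt_norm_sq z).hasFDerivAt
  have h2 := (hasStrictFDerivAt_norm_sq (N z)).hasFDerivAt.comp z N.hasFDerivAt
  exact h1.add h2

/-- The angle of the twist map at `z`: equal to `β` at the origin, and to `0` far away. -/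
def twistAngle (N : Plane →L[ℝ] Plane) (β r : ℝ) (z : Plane) : ℝ :=
  β * cutoff (quad N z / r ^ 2)

/-- The twist map: each ellipse `quad N = const` is rotated by an angle that depends on the
ellipse. -/
def twist (N : Plane →L[ℝ] Plane) (β r : ℝ) (z : Plane) : Plane :=
  rot N (twistAngle N β r z) z

lemma twist_twist_neg {N : Plane →L[ℝ] Plane} (hN : ∀ z, N (N z) = -z) (β r : ℝ) (z : Plane) :
    twist N β r (twist N (-β) r z) = z := by
  have h : twistAngle N β r (twist N (-β) r z) = -twistAngle N (-β) r z := by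
    simp only [twistAngle, twist, quad_rot hN]
    ring
  rw [twist, h, twist]
  simpa using rot_rot_neg hN (-twistAngle N (-β) r z) z

/-- The derivative of the angle of the twist map. -/
def twistAngleDeriv (N : Plane →L[ℝ] Plane) (β r : ℝ) (z : Plane) : Plane →L[ℝ] ℝ :=
  (β * (deriv cutoff (quad N z / r ^ 2) / r ^ 2)) •
    (2 • innerSL ℝ z + 2 • (innerSL ℝ (N z)).comp N)

lemma hasFDerivAt_twistAngle (N : Plane →L[ℝ] Plane) (β r : ℝ) (z : Plane) :
    HasFDerivAt (twistAngle N β r) (twistAngleDeriv N β r z) z := by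
  have h1 : HasDerivAt cutoff (deriv cutoff (quad N z / r ^ 2)) (quad N z / r ^ 2) :=
    (contDiff_cutoff.differentiable one_ne_zero _).hasDerivAt
  have h2 := ((hasFDerivAt_quad N z).mul_const (r ^ 2)⁻¹)
  have h3 := (h1.comp_hasFDerivAt z (by simpa [div_eq_mul_inv] using h2)).const_mul β
  have hfun : twistAngle N β r = fun y => β * (cutoff ∘ fun y => quad N y * (r ^ 2)⁻¹) y := by
    funext y
    simp [twistAngle, div_eq_mul_inv]
  rw [hfun]
  refine h3.congr_fderiv ?_
  ext1 v
  simp [twistAngleDeriv]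
  ring

/-- The angle is constant along the ellipses, whose tangent direction at `z` is `N z`. -/
lemma twistAngleDeriv_apply_N {N : Plane →L[ℝ] Plane} (hN : ∀ z, N (N z) = -z) (β r : ℝ)
    (z : Plane) : twistAngleDeriv N β r z (N z) = 0 := by
  simp [twistAngleDeriv, hN, real_inner_comm (N z) z, inner_neg_right]

lemma hasFDerivAt_twist {N : Plane →L[ℝ] Plane} (hN : ∀ z, N (N z) = -z) (β r : ℝ) (z : Plane) :
    HasFDerivAt (twist N β r) ((rot N (twistAngle N β r z)).comp
      (ContinuousLinearMap.id ℝ Plane + (twistAngleDeriv N β r z).smulRight (N z))) z := by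
  have h := hasFDerivAt_twistAngle N β r z
  have h1 := (h.cos.smul (hasFDerivAt_id z)).add (h.sin.smul N.hasFDerivAt)
  refine h1.congr_fderiv ?_
  ext1 v
  simp [rot_apply, hN, smul_smul]
  module

lemma contDiff_twist (N : Plane →L[ℝ] Plane) (β r : ℝ) : ContDiff ℝ 1 (twist N β r) := by
  have hq : ContDiff ℝ 1 (quad N) := (contDiff_norm_sq ℝ).add ((contDiff_norm_sq ℝ).comp N.contDiff)
  have ha : ContDiff ℝ 1 (twistAngle N β r) :=
    contDiff_const.mul (contDiff_cutoff.comp (hq.div_const _))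
  exact (ha.cos.smul contDiff_id).add (ha.sin.smul N.contDiff)

lemma det_rot {N : Plane →L[ℝ] Plane} (hN : ∀ z, N (N z) = -z) (t : ℝ) : (rot N t).det = 1 := by
  have e0 := hN e₀
  have e1 := hN e₁
  set a := (N e₀) 0 with ha
  set c := (N e₀) 1 with hc
  set b := (N e₁) 0 with hb
  set d := (N e₁) 1 with hd
  have hNe0 : N e₀ = a • e₀ + c • e₁ := plane_eq _
  have hNe1 : N e₁ = b • e₀ + d • e₁ := plane_eq _
  rw [hNe0, map_add, map_smul, map_smul, hNe0, hNe1] at e0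
  rw [hNe1, map_add, map_smul, map_smul, hNe0, hNe1] at e1
  have h1 := congrArg (fun v : Plane => v 0) e0
  have h2 := congrArg (fun v : Plane => v 1) e0
  have h3 := congrArg (fun v : Plane => v 0) e1
  have h4 := congrArg (fun v : Plane => v 1) e1
  simp at h1 h2 h3 h4
  -- a complex structure has trace `0`, and determinant `1`
  have htr : a + d = 0 := by
    by_contra h0
    have hc0 : c = 0 := by
      have : c * (a + d) = 0 := by linarith
      exact (mul_eq_zero.1 this).resolve_right h0
    rw [hc0] at h1
    nlinarith [sq_nonneg a]
  have hsq := Real.cos_sq_add_sin_sq t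
  rw [det_plane]
  simp only [rot_apply, PiLp.add_apply, PiLp.smul_apply, smul_eq_mul, ← ha, ← hb, ← hc, ← hd]
  have hd' : d = -a := by linarith
  simp [hd']
  linear_combination hsq - Real.sin t ^ 2 * h1

lemma det_id_add_smulRight (φ : Plane →L[ℝ] ℝ) (n : Plane) :
    (ContinuousLinearMap.id ℝ Plane + φ.smulRight n).det = 1 + φ n := by
  have h : φ n = n 0 * φ e₀ + n 1 * φ e₁ := by
    conv_lhs => rw [plane_eq n]
    simp
  rw [det_plane, h]
  simp
  ring

lemma det_comp (A B : Plane →L[ℝ] Plane) : (A.comp B).det = A.det * B.det :=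
  LinearMap.det_comp _ _

lemma norm_rot_sub_le {N : Plane →L[ℝ] Plane} (hN2 : ‖N‖ ≤ 2) (t : ℝ) :
    ‖rot N t - ContinuousLinearMap.id ℝ Plane‖ ≤ 3 * |t| := by
  have h : rot N t - ContinuousLinearMap.id ℝ Plane =
      (Real.cos t - 1) • ContinuousLinearMap.id ℝ Plane + Real.sin t • N := by
    rw [rot]; module
  have hcos : |Real.cos t - 1| ≤ |t| := by
    simpa using Real.abs_cos_sub_cos_le t 0
  have hsin : |Real.sin t| ≤ |t| := Real.abs_sin_le_abs
  rw [h]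
  calc _ ≤ ‖(Real.cos t - 1) • ContinuousLinearMap.id ℝ Plane‖ + ‖Real.sin t • N‖ := norm_add_le _ _
    _ = |Real.cos t - 1| * ‖ContinuousLinearMap.id ℝ Plane‖ + |Real.sin t| * ‖N‖ := by
        rw [norm_smul, norm_smul, Real.norm_eq_abs, Real.norm_eq_abs]
    _ ≤ |t| * 1 + |t| * 2 := by
        gcongr
        exact ContinuousLinearMap.norm_id_le
    _ = 3 * |t| := by ring

/-- An area-preserving `C^1` diffeomorphism of the plane that fixes the origin, is the identity
off the disc of radius `r`, and is `δ`-close to the identity in the `C^1` sense, as well as its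
inverse. -/
structure IsSmallAreaMap (r δ : ℝ) (h : Plane ≃ Plane) : Prop where
  contDiff : ContDiff ℝ 1 h
  contDiff_symm : ContDiff ℝ 1 h.symm
  eq_self : ∀ z, r ≤ ‖z‖ → h z = z
  map_zero : h 0 = 0
  norm_fderiv_sub_le : ∀ z, ‖fderiv ℝ h z - ContinuousLinearMap.id ℝ Plane‖ ≤ δ
  norm_fderiv_symm_sub_le : ∀ z, ‖fderiv ℝ h.symm z - ContinuousLinearMap.id ℝ Plane‖ ≤ δ
  abs_det : ∀ z, |(fderiv ℝ h z).det| = 1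

lemma norm_comp_sub_le {A B : Plane →L[ℝ] Plane} {a b : ℝ}
    (hA : ‖A - ContinuousLinearMap.id ℝ Plane‖ ≤ a)
    (hB : ‖B - ContinuousLinearMap.id ℝ Plane‖ ≤ b) :
    ‖A.comp B - ContinuousLinearMap.id ℝ Plane‖ ≤ a * (1 + b) + b := by
  have h : A.comp B - ContinuousLinearMap.id ℝ Plane =
      (A - ContinuousLinearMap.id ℝ Plane).comp B + (B - ContinuousLinearMap.id ℝ Plane) := by
    ext1 v
    simp
  have hB' : ‖B‖ ≤ 1 + b := by
    calc ‖B‖ = ‖ContinuousLinearMap.id ℝ Plane + (B - ContinuousLinearMap.id ℝ Plane)‖ := by simp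
      _ ≤ ‖ContinuousLinearMap.id ℝ Plane‖ + ‖B - ContinuousLinearMap.id ℝ Plane‖ := norm_add_le _ _
      _ ≤ 1 + b := add_le_add ContinuousLinearMap.norm_id_le hB
  have ha : 0 ≤ a := (norm_nonneg _).trans hA
  rw [h]
  refine (norm_add_le _ _).trans (add_le_add ?_ hB)
  exact (ContinuousLinearMap.opNorm_comp_le _ _).trans
    (mul_le_mul hA hB' (norm_nonneg _) ha)

lemma norm_fderiv_twist_sub_le {N : Plane →L[ℝ] Plane} (hN : ∀ z, N (N z) = -z) (hN2 : ‖N‖ ≤ 2)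
    {C : ℝ} (hC : ∀ s, 0 ≤ s → |deriv cutoff s| * s ≤ C) {β r : ℝ} (hβ : |β| ≤ 1) (hr : 0 < r)
    (z : Plane) :
    ‖fderiv ℝ (twist N β r) z - ContinuousLinearMap.id ℝ Plane‖ ≤ (3 + 24 * C) * |β| := by
  rw [(hasFDerivAt_twist hN β r z).fderiv]
  have hangle : |twistAngle N β r z| ≤ |β| := by
    rw [twistAngle, abs_mul]
    exact mul_le_of_le_one_right (abs_nonneg _) (abs_cutoff_le _)
  have hA := (norm_rot_sub_le hN2 (twistAngle N β r z)).trans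
    (mul_le_mul_of_nonneg_left hangle (by norm_num))
  have hq0 : 0 ≤ quad N z := by unfold quad; positivity
  set s := quad N z / r ^ 2 with hs
  have hs0 : 0 ≤ s := by positivity
  have hC0 : 0 ≤ C := le_trans (by positivity) (hC 0 le_rfl)
  have hD : ‖(2 • innerSL ℝ z + 2 • (innerSL ℝ (N z)).comp N : Plane →L[ℝ] ℝ)‖ ≤
      2 * ‖z‖ + 4 * ‖N z‖ := by
    refine (norm_add_le _ _).trans ?_
    rw [two_smul, two_smul]
    have h1 : ‖innerSL ℝ z‖ = ‖z‖ := innerSL_apply_norm ℝ z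
    have h2 : ‖(innerSL ℝ (N z)).comp N‖ ≤ ‖N z‖ * 2 := by
      refine (ContinuousLinearMap.opNorm_comp_le _ _).trans ?_
      rw [innerSL_apply_norm]
      gcongr
    have h3 := norm_add_le (innerSL ℝ z) (innerSL ℝ z)
    have h4 := norm_add_le ((innerSL ℝ (N z)).comp N) ((innerSL ℝ (N z)).comp N)
    linarith
  have hB : ‖(ContinuousLinearMap.id ℝ Plane + (twistAngleDeriv N β r z).smulRight (N z)) -
      ContinuousLinearMap.id ℝ Plane‖ ≤ 6 * C * |β| := by
    rw [add_sub_cancel_left, ContinuousLinearMap.norm_smulRight_apply, twistAngleDeriv, norm_smul,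
      Real.norm_eq_abs, abs_mul, abs_div, abs_of_pos (show 0 < r ^ 2 by positivity), ← hs]
    have h5 : (2 * ‖z‖ + 4 * ‖N z‖) * ‖N z‖ ≤ 6 * quad N z := by
      unfold quad
      nlinarith [sq_nonneg (‖z‖ - ‖N z‖), sq_nonneg ‖z‖, sq_nonneg ‖N z‖]
    calc _ ≤ |β| * (|deriv cutoff s| / r ^ 2) * (2 * ‖z‖ + 4 * ‖N z‖) * ‖N z‖ := by gcongr
      _ = |β| * (|deriv cutoff s| / r ^ 2) * ((2 * ‖z‖ + 4 * ‖N z‖) * ‖N z‖) := by ring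
      _ ≤ |β| * (|deriv cutoff s| / r ^ 2) * (6 * quad N z) := by gcongr
      _ = 6 * |β| * (|deriv cutoff s| * s) := by rw [hs]; ring
      _ ≤ 6 * |β| * C := by gcongr; exact hC s hs0
      _ = 6 * C * |β| := by ring
  refine (norm_comp_sub_le hA hB).trans ?_
  have hββ : |β| * |β| ≤ |β| := mul_le_of_le_one_right (abs_nonneg _) hβ
  nlinarith [mul_le_mul_of_nonneg_left hββ hC0, abs_nonneg β]

/-- Twist maps of angle `β` with support in an arbitrarily small disc: their distance to the identity
is of order `β`, uniformly in the support. -/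
lemma exists_twist_bound : ∃ C : ℝ, 0 < C ∧ ∀ N : Plane →L[ℝ] Plane, (∀ z, N (N z) = -z) →
    ‖N‖ ≤ 2 → ∀ β : ℝ, |β| ≤ 1 → ∀ r : ℝ, 0 < r → ∃ h : Plane ≃ Plane,
      IsSmallAreaMap r (C * |β|) h ∧ fderiv ℝ h 0 = rot N β := by
  obtain ⟨C, hC0, hC⟩ := exists_cutoff_bound
  refine ⟨3 + 24 * C, by positivity, fun N hN hN2 β hβ r hr => ?_⟩
  refine ⟨⟨twist N β r, twist N (-β) r, fun z => ?_, fun z => twist_twist_neg hN β r z⟩,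
    ⟨contDiff_twist N β r, contDiff_twist N (-β) r, fun z hz => ?_, ?_,
    norm_fderiv_twist_sub_le hN hN2 hC hβ hr, fun z => ?_, fun z => ?_⟩, ?_⟩
  · simpa using twist_twist_neg hN (-β) r z
  · have hq : 1 ≤ quad N z / r ^ 2 := by
      rw [le_div_iff₀ (by positivity), one_mul]
      have := pow_le_pow_left₀ hr.le hz 2
      unfold quad
      nlinarith [sq_nonneg ‖N z‖]
    simp [twist, twistAngle, cutoff_of_one_le hq, rot_apply]
  · simp [twist, rot_apply]
  · have := norm_fderiv_twist_sub_le hN hN2 hC (β := -β) (by rwa [abs_neg]) hr z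
    rwa [abs_neg] at this
  · change |(fderiv ℝ (twist N β r) z).det| = 1
    rw [(hasFDerivAt_twist hN β r z).fderiv, det_comp, det_rot hN, det_id_add_smulRight,
      twistAngleDeriv_apply_N hN]
    simp
  · change fderiv ℝ (twist N β r) 0 = rot N β
    rw [(hasFDerivAt_twist hN β r 0).fderiv]
    ext1 v
    simp [twistAngle, quad, cutoff_zero]

lemma IsSmallAreaMap.trans {r δ₁ δ₂ : ℝ} {h₁ h₂ : Plane ≃ Plane} (H₁ : IsSmallAreaMap r δ₁ h₁)
    (H₂ : IsSmallAreaMap r δ₂ h₂) :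
    IsSmallAreaMap r (δ₁ + δ₂ + δ₁ * δ₂) (h₁.trans h₂) := by
  have hd1 := fun z => H₁.contDiff.differentiable one_ne_zero z
  have hd2 := fun z => H₂.contDiff.differentiable one_ne_zero z
  have hd1' := fun z => H₁.contDiff_symm.differentiable one_ne_zero z
  have hd2' := fun z => H₂.contDiff_symm.differentiable one_ne_zero z
  refine ⟨H₂.contDiff.comp H₁.contDiff, H₁.contDiff_symm.comp H₂.contDiff_symm, fun z hz => ?_,
    ?_, fun z => ?_, fun z => ?_, fun z => ?_⟩
  · simp [H₁.eq_self z hz, H₂.eq_self z hz]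
  · simp [H₁.map_zero, H₂.map_zero]
  · rw [Equiv.coe_trans, fderiv_comp z (hd2 _) (hd1 z)]
    refine (norm_comp_sub_le (H₂.norm_fderiv_sub_le _) (H₁.norm_fderiv_sub_le _)).trans
      (le_of_eq (by ring))
  · rw [Equiv.symm_trans, Equiv.coe_trans, fderiv_comp z (hd1' _) (hd2' z)]
    refine (norm_comp_sub_le (H₁.norm_fderiv_symm_sub_le _)
      (H₂.norm_fderiv_symm_sub_le _)).trans (le_of_eq (by ring))
  · rw [Equiv.coe_trans, fderiv_comp z (hd2 _) (hd1 z), det_comp, abs_mul, H₁.abs_det, H₂.abs_det,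
      one_mul]

end Twist

/-! ### Factorization of linear maps into rotations -/

section Factorization

/-- The rotation of the plane by a right angle. -/
def quarterTurn : Plane →L[ℝ] Plane :=
  (EuclideanSpace.proj 0 : Plane →L[ℝ] ℝ).smulRight e₁ -
    (EuclideanSpace.proj 1 : Plane →L[ℝ] ℝ).smulRight e₀

lemma quarterTurn_apply (z : Plane) : quarterTurn z = z 0 • e₁ - z 1 • e₀ := rfl

lemma quarterTurn_quarterTurn (z : Plane) : quarterTurn (quarterTurn z) = -z := by
  ext i
  fin_cases i <;> simp [quarterTurn_apply]

lemma norm_quarterTurn_le : ‖quarterTurn‖ ≤ 1 := by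
  refine ContinuousLinearMap.opNorm_le_bound _ zero_le_one fun z => ?_
  rw [one_mul]
  refine le_of_eq ?_
  rw [EuclideanSpace.norm_eq, EuclideanSpace.norm_eq, Fin.sum_univ_two, Fin.sum_univ_two]
  simp [quarterTurn_apply, add_comm]

/-- Half the trace of an endomorphism of the plane. -/
def halfTrace (B : Plane →L[ℝ] Plane) : ℝ := ((B e₀) 0 + (B e₁) 1) / 2

lemma cayley_hamilton (B : Plane →L[ℝ] Plane) (z : Plane) :
    B (B z) = (2 * halfTrace B) • B z - B.det • z := by
  have hB0 : B e₀ = (B e₀) 0 • e₀ + (B e₀) 1 • e₁ := plane_eq _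
  have hB1 : B e₁ = (B e₁) 0 • e₀ + (B e₁) 1 • e₁ := plane_eq _
  have hz : ∀ w : Plane, B w = w 0 • B e₀ + w 1 • B e₁ := fun w => by
    conv_lhs => rw [plane_eq w]
    simp
  rw [hz (B z), hz z, det_plane, halfTrace]
  ext i
  fin_cases i
  · simp
    ring
  · simp
    ring

/-- An elliptic map of determinant one is a rotation for some complex structure. -/
lemma exists_complex_structure {B : Plane →L[ℝ] Plane} {β : ℝ} (hdet : B.det = 1)
    (hβ : Real.cos β = halfTrace B) (hs : Real.sin β ≠ 0) :
    ∀ z, ((Real.sin β)⁻¹ • (B - Real.cos β • ContinuousLinearMap.id ℝ Plane))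
      (((Real.sin β)⁻¹ • (B - Real.cos β • ContinuousLinearMap.id ℝ Plane)) z) = -z := by
  intro z
  have h := Real.cos_sq_add_sin_sq β
  have hc : 1 - Real.cos β ^ 2 = Real.sin β ^ 2 := by linarith
  simp only [smul_apply, sub_apply,
    ContinuousLinearMap.id_apply, map_smul, map_sub, cayley_hamilton B z, hdet, ← hβ]
  calc _ = ((Real.sin β)⁻¹ * (Real.sin β)⁻¹) • (-(1 - Real.cos β ^ 2)) • z := by module
    _ = -z := by
      rw [hc, smul_smul]
      have : (Real.sin β)⁻¹ * (Real.sin β)⁻¹ * -Real.sin β ^ 2 = -1 := by field_simp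
      rw [this, neg_one_smul]

/-- Every area-preserving linear map close to the identity is the product of two rotations of
small angles, for two complex structures of bounded norms. -/
lemma exists_factorization {ε : ℝ} (hε : 0 < ε) (hε1 : ε ≤ 1) :
    ∃ ζ : ℝ, 0 < ζ ∧ ∀ A : Plane →L[ℝ] Plane, |A.det| = 1 →
      ‖A - ContinuousLinearMap.id ℝ Plane‖ < ζ →
      ∃ (N : Plane →L[ℝ] Plane) (β : ℝ), (∀ z, N (N z) = -z) ∧ ‖N‖ ≤ 2 ∧ |β| ≤ 2 * ε ∧
        A = (rot N β).comp (rot quarterTurn (-ε)) := by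
  set E := rot quarterTurn ε with hE
  -- `A.comp E` is elliptic, of angle close to `ε`, when `A` is close to the identity
  set ang : (Plane →L[ℝ] Plane) → ℝ := fun A => Real.arccos (halfTrace (A.comp E)) with hang
  set str : (Plane →L[ℝ] Plane) → (Plane →L[ℝ] Plane) := fun A =>
    (Real.sin (ang A))⁻¹ • (A.comp E - Real.cos (ang A) • ContinuousLinearMap.id ℝ Plane) with hstr
  have hsin : 0 < Real.sin ε := Real.sin_pos_of_pos_of_lt_pi hε (by linarith [Real.pi_gt_three])
  have hhalf1 : halfTrace E = Real.cos ε := by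
    simp [halfTrace, hE, rot_apply, quarterTurn_apply]
  have hang1 : ang (ContinuousLinearMap.id ℝ Plane) = ε := by
    simp only [hang, ContinuousLinearMap.id_comp, hhalf1]
    exact Real.arccos_cos hε.le (by linarith [Real.pi_gt_three])
  have hstr1 : str (ContinuousLinearMap.id ℝ Plane) = quarterTurn := by
    simp only [hstr, hang1, ContinuousLinearMap.id_comp, hE, rot, add_sub_cancel_left, smul_smul,
      inv_mul_cancel₀ hsin.ne', one_smul]
  have hcomp : Continuous fun A : Plane →L[ℝ] Plane => A.comp E := by fun_prop
  have hhalf : Continuous fun A : Plane →L[ℝ] Plane => halfTrace (A.comp E) := by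
    unfold halfTrace
    simp only [ContinuousLinearMap.comp_apply]
    fun_prop
  have hangc : Continuous ang := Real.continuous_arccos.comp hhalf
  have hdetc : Continuous fun A : Plane →L[ℝ] Plane => A.det := by
    have : (fun A : Plane →L[ℝ] Plane => A.det) = fun A =>
        (A e₀) 0 * (A e₁) 1 - (A e₀) 1 * (A e₁) 0 := funext det_plane
    rw [this]
    fun_prop
  have hsin1 : Real.sin (ang (ContinuousLinearMap.id ℝ Plane)) ≠ 0 := by rw [hang1]; exact hsin.ne'
  have hstrc : ContinuousAt str (ContinuousLinearMap.id ℝ Plane) := by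
    have hcos : Continuous fun A => Real.cos (ang A) := Real.continuous_cos.comp hangc
    have h1 : ContinuousAt (fun A => (Real.sin (ang A))⁻¹) (ContinuousLinearMap.id ℝ Plane) :=
      (Real.continuous_sin.comp hangc).continuousAt.inv₀ hsin1
    have h2 : Continuous fun A : Plane →L[ℝ] Plane =>
        A.comp E - Real.cos (ang A) • ContinuousLinearMap.id ℝ Plane :=
      hcomp.sub (hcos.smul continuous_const)
    exact h1.smul h2.continuousAt
  have hev : ∀ᶠ A in 𝓝 (ContinuousLinearMap.id ℝ Plane), ‖str A‖ < 2 ∧ ang A < 2 * ε ∧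
      Real.sin (ang A) ≠ 0 ∧ |halfTrace (A.comp E)| < 1 ∧ 0 < A.det := by
    refine (hstrc.norm.eventually_lt_const ?_).and
      ((hangc.continuousAt.eventually_lt_const ?_).and
      (((Real.continuous_sin.comp hangc).continuousAt.eventually_ne hsin1).and
      ((hhalf.abs.continuousAt.eventually_lt_const ?_).and
      (hdetc.continuousAt.eventually_const_lt ?_))))
    · change ‖str (ContinuousLinearMap.id ℝ Plane)‖ < 2
      rw [hstr1]
      exact norm_quarterTurn_le.trans_lt one_lt_two
    · rw [hang1]
      linarith
    · change |halfTrace ((ContinuousLinearMap.id ℝ Plane).comp E)| < 1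
      rw [ContinuousLinearMap.id_comp, hhalf1, ← sq_lt_one_iff_abs_lt_one]
      nlinarith [Real.cos_sq_add_sin_sq ε, sq_pos_of_pos hsin]
    · simp [det_plane]
  obtain ⟨ζ, hζ, hball⟩ := Metric.eventually_nhds_iff.1 hev
  refine ⟨ζ, hζ, fun A hA hAζ => ?_⟩
  obtain ⟨h1, h2, h3, h4, h5⟩ := hball (by rwa [dist_eq_norm] : dist A _ < ζ)
  have hdetA : A.det = 1 := by rwa [abs_of_pos h5] at hA
  have hdet : (A.comp E).det = 1 := by
    rw [det_comp, hdetA, hE, det_rot quarterTurn_quarterTurn, one_mul]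
  have hcos : Real.cos (ang A) = halfTrace (A.comp E) :=
    Real.cos_arccos (abs_lt.1 h4).1.le (abs_lt.1 h4).2.le
  refine ⟨str A, ang A, exists_complex_structure hdet hcos h3, h1.le, ?_, ?_⟩
  · rw [abs_of_nonneg (Real.arccos_nonneg _)]
    exact h2.le
  · have hrot : rot (str A) (ang A) = A.comp E := by
      simp only [rot, hstr, smul_smul, mul_inv_cancel₀ h3, one_smul, add_sub_cancel]
    rw [hrot]
    ext1 v
    simp only [ContinuousLinearMap.comp_apply, hE]
    rw [rot_rot_neg quarterTurn_quarterTurn]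

/-- Franks' lemma at the origin of the plane: an area-preserving linear map
close to the identity is the derivative at the origin of an area-preserving diffeomorphism with
arbitrarily small support, and the distance of that diffeomorphism to the identity does not depend
on the support. -/
theorem exists_isSmallAreaMap {δ : ℝ} (hδ : 0 < δ) :
    ∃ ζ : ℝ, 0 < ζ ∧ ∀ A : Plane →L[ℝ] Plane, |A.det| = 1 →
      ‖A - ContinuousLinearMap.id ℝ Plane‖ < ζ → ∀ r : ℝ, 0 < r →
      ∃ h : Plane ≃ Plane, IsSmallAreaMap r δ h ∧ fderiv ℝ h 0 = A := by
  obtain ⟨C, hC, htw⟩ := exists_twist_bound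
  set ε := min (1 / 2) (min 1 (δ / 3) / (2 * C)) with hεdef
  have hε : 0 < ε := by positivity
  have hε2 : 2 * ε ≤ 1 := by
    have := min_le_left (1 / 2) (min 1 (δ / 3) / (2 * C))
    linarith
  have hk : C * (2 * ε) ≤ min 1 (δ / 3) := by
    have := min_le_right (1 / 2) (min 1 (δ / 3) / (2 * C))
    rw [← hεdef, le_div_iff₀ (by positivity)] at this
    linarith
  obtain ⟨ζ, hζ, hfac⟩ := exists_factorization hε (by linarith)
  refine ⟨ζ, hζ, fun A hA hAζ r hr => ?_⟩
  obtain ⟨N, β, hN, hN2, hβ, rfl⟩ := hfac A hA hAζ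
  obtain ⟨h₁, H₁, hd₁⟩ := htw quarterTurn quarterTurn_quarterTurn
    (norm_quarterTurn_le.trans one_le_two) (-ε) (by rw [abs_neg, abs_of_pos hε]; linarith) r hr
  obtain ⟨h₂, H₂, hd₂⟩ := htw N hN hN2 β (hβ.trans hε2) r hr
  have H := H₁.trans H₂
  refine ⟨h₁.trans h₂, { H with norm_fderiv_sub_le := ?_, norm_fderiv_symm_sub_le := ?_ }, ?_⟩
  rotate_left 2
  · rw [Equiv.coe_trans, fderiv_comp 0 (H₂.contDiff.differentiable one_ne_zero _)
      (H₁.contDiff.differentiable one_ne_zero _), H₁.map_zero, hd₁, hd₂]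
  all_goals
    have hb1 : C * |(-ε)| ≤ min 1 (δ / 3) := by
      rw [abs_neg, abs_of_pos hε]
      exact le_trans (by gcongr; linarith) hk
    have hb2 : C * |β| ≤ min 1 (δ / 3) := le_trans (by gcongr) hk
    have hbound : C * |(-ε)| + C * |β| + C * |(-ε)| * (C * |β|) ≤ δ := by
      have h1 := hb1.trans (min_le_left _ _)
      have h2 := hb1.trans (min_le_right _ _)
      have h3 := hb2.trans (min_le_right _ _)
      have h4 : C * |(-ε)| * (C * |β|) ≤ C * |β| := mul_le_of_le_one_left (by positivity) h1
      linarith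
  · exact fun z => (H.norm_fderiv_sub_le z).trans hbound
  · exact fun z => (H.norm_fderiv_symm_sub_le z).trans hbound

end Factorization

/-! ### Transport of planar maps to the surface -/

section InverseMap

lemma IsSmallAreaMap.symm {r δ : ℝ} {h : Plane ≃ Plane} (H : IsSmallAreaMap r δ h) :
    IsSmallAreaMap r δ h.symm := by
  refine ⟨H.contDiff_symm, H.contDiff, fun z hz => ?_, ?_, H.norm_fderiv_symm_sub_le,
    H.norm_fderiv_sub_le, fun z => ?_⟩
  · rw [Equiv.symm_apply_eq, H.eq_self z hz]
  · rw [Equiv.symm_apply_eq, H.map_zero]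
  · have h1 : (fderiv ℝ h (h.symm z)).comp (fderiv ℝ h.symm z) =
        ContinuousLinearMap.id ℝ Plane := by
      rw [← fderiv_comp z (H.contDiff.differentiable one_ne_zero _)
        (H.contDiff_symm.differentiable one_ne_zero _), h.self_comp_symm, fderiv_id]
    have h2 := congrArg (fun B : Plane →L[ℝ] Plane => |B.det|) h1
    simp only [det_comp, abs_mul, H.abs_det, one_mul] at h2
    rw [h2]
    simp [det_plane]

lemma IsSmallAreaMap.norm_lt {r δ : ℝ} {h : Plane ≃ Plane} (H : IsSmallAreaMap r δ h) {z : Plane}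
    (hz : ‖z‖ < r) : ‖h z‖ < r := by
  by_contra hlt
  have h1 := h.injective (H.eq_self _ (not_lt.1 hlt))
  rw [h1] at hlt
  exact hlt hz

lemma IsSmallAreaMap.apply_mem {r δ : ℝ} {h : Plane ≃ Plane} (H : IsSmallAreaMap r δ h)
    {T : Set Plane} (hT : Metric.closedBall 0 r ⊆ T) {z : Plane} (hz : z ∈ T) : h z ∈ T := by
  rcases lt_or_ge ‖z‖ r with hlt | hge
  · exact hT (by simpa using (H.norm_lt hlt).le)
  · rwa [H.eq_self z hge]

lemma IsSmallAreaMap.norm_sub_le {r δ : ℝ} {h : Plane ≃ Plane} (H : IsSmallAreaMap r δ h)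
    (hr : 0 ≤ r) (z : Plane) : ‖h z - z‖ ≤ 2 * r := by
  rcases lt_or_ge ‖z‖ r with hlt | hge
  · have h1 := H.norm_lt hlt
    have h2 := _root_.norm_sub_le (h z) z
    linarith
  · rw [H.eq_self z hge, sub_self, norm_zero]
    linarith

end InverseMap

section Transport

variable {M : Type*} [TopologicalSpace M]

open Classical in
/-- The map of `M` which is `h` in the chart `e`, and the identity off the domain of `e`. -/
def transport (e : OpenPartialHomeomorph M Plane) (h : Plane → Plane) (p : M) : M :=
  if p ∈ e.source then e.symm (h (e p)) else p

lemma transport_of_mem {e : OpenPartialHomeomorph M Plane} (h : Plane → Plane) {p : M}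
    (hp : p ∈ e.source) : transport e h p = e.symm (h (e p)) := if_pos hp

lemma transport_of_notMem {e : OpenPartialHomeomorph M Plane} (h : Plane → Plane) {p : M}
    (hp : p ∉ e.source) : transport e h p = p := if_neg hp

lemma transport_transport_symm {e : OpenPartialHomeomorph M Plane} {r δ : ℝ} {h : Plane ≃ Plane}
    (H : IsSmallAreaMap r δ h) (hr : Metric.closedBall 0 r ⊆ e.target) (p : M) :
    transport e h.symm (transport e h p) = p := by
  by_cases hp : p ∈ e.source
  · have h1 := H.apply_mem hr (e.map_source hp)
    rw [transport_of_mem h hp, transport_of_mem _ (e.map_target h1), e.right_inv h1,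
      Equiv.symm_apply_apply, e.left_inv hp]
  · rw [transport_of_notMem h hp, transport_of_notMem _ hp]

lemma transport_eventuallyEq_of_mem {e : OpenPartialHomeomorph M Plane} (h : Plane → Plane) {p : M}
    (hp : p ∈ e.source) : transport e h =ᶠ[𝓝 p] fun q => e.symm (h (e q)) := by
  filter_upwards [e.open_source.mem_nhds hp] with q hq using transport_of_mem h hq

lemma transport_eq_self {e : OpenPartialHomeomorph M Plane} {r δ : ℝ} {h : Plane ≃ Plane}
    (H : IsSmallAreaMap r δ h) {p : M} (hp : p ∉ e.symm '' Metric.closedBall 0 r) :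
    transport e h p = p := by
  by_cases hps : p ∈ e.source
  · have h1 : r ≤ ‖e p‖ := by
      by_contra hlt
      exact hp ⟨e p, by simpa using (not_le.1 hlt).le, e.left_inv hps⟩
    rw [transport_of_mem h hps, H.eq_self _ h1, e.left_inv hps]
  · exact transport_of_notMem h hps

lemma isCompact_image_closedBall {e : OpenPartialHomeomorph M Plane} {r : ℝ}
    (hr : Metric.closedBall 0 r ⊆ e.target) : IsCompact (e.symm '' Metric.closedBall 0 r) :=
  (isCompact_closedBall 0 r).image_of_continuousOn (e.continuousOn_symm.mono hr)

variable [T2Space M]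

lemma transport_eventuallyEq_id {e : OpenPartialHomeomorph M Plane} {r δ : ℝ} {h : Plane ≃ Plane}
    (H : IsSmallAreaMap r δ h) (hr : Metric.closedBall 0 r ⊆ e.target) {p : M}
    (hp : p ∉ e.symm '' Metric.closedBall 0 r) : transport e h =ᶠ[𝓝 p] id := by
  filter_upwards [(isCompact_image_closedBall hr).isClosed.isOpen_compl.mem_nhds hp] with q hq
    using transport_eq_self H hq

variable [ChartedSpace Plane M]

lemma contMDiff_transport {e : OpenPartialHomeomorph M Plane}
    (he : e ∈ IsManifold.maximalAtlas (𝓡 2) 1 M) {r δ : ℝ} {h : Plane ≃ Plane}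
    (H : IsSmallAreaMap r δ h) (hr : Metric.closedBall 0 r ⊆ e.target) :
    ContMDiff (𝓡 2) (𝓡 2) 1 (transport e h) := by
  intro p
  by_cases hp : p ∈ e.source
  · have h1 : ContMDiffAt (𝓡 2) (𝓡 2) 1 (h ∘ e) p :=
      (H.contDiff.contMDiff _).comp p (contMDiffAt_of_mem_maximalAtlas he hp)
    have h2 : ContMDiffAt (𝓡 2) (𝓡 2) 1 (e.symm ∘ (h ∘ e)) p :=
      (contMDiffAt_symm_of_mem_maximalAtlas he (H.apply_mem hr (e.map_source hp))).comp p h1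
    exact h2.congr_of_eventuallyEq (transport_eventuallyEq_of_mem h hp)
  · refine contMDiffAt_id.congr_of_eventuallyEq (transport_eventuallyEq_id H hr ?_)
    rintro ⟨z, hz, rfl⟩
    exact hp (e.map_target (hr hz))

/-- The diffeomorphism of `M` which is `h` in the chart `e`, and the identity elsewhere. -/
def transportDiffeo {e : OpenPartialHomeomorph M Plane}
    (he : e ∈ IsManifold.maximalAtlas (𝓡 2) 1 M) {r δ : ℝ} {h : Plane ≃ Plane}
    (H : IsSmallAreaMap r δ h) (hr : Metric.closedBall 0 r ⊆ e.target) : Diff1 M where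
  toFun := transport e h
  invFun := transport e h.symm
  left_inv := transport_transport_symm H hr
  right_inv := transport_transport_symm H.symm hr
  contMDiff_toFun := contMDiff_transport he H hr
  contMDiff_invFun := contMDiff_transport he H.symm hr

end Transport

section TangentMap

variable {M : Type*} [TopologicalSpace M] [ChartedSpace Plane M]

lemma tangentMap_congr {H₁ H₂ : Type*} [TopologicalSpace H₁] [ChartedSpace Plane H₁]
    [TopologicalSpace H₂] [ChartedSpace Plane H₂] {f g : H₁ → H₂} {p : TangentBundle (𝓡 2) H₁}
    (h : f =ᶠ[𝓝 p.proj] g) : tangentMap (𝓡 2) (𝓡 2) f p = tangentMap (𝓡 2) (𝓡 2) g p := by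
  refine Bundle.TotalSpace.ext h.self_of_nhds ?_
  exact heq_of_eq (congrArg (fun L : Plane →L[ℝ] Plane => L p.2) h.mfderiv_eq)

lemma tangentMap_transport_eq_self [T2Space M] {e : OpenPartialHomeomorph M Plane} {r δ : ℝ}
    {h : Plane ≃ Plane} (H : IsSmallAreaMap r δ h) (hr : Metric.closedBall 0 r ⊆ e.target)
    {p : TangentBundle (𝓡 2) M} (hp : p.proj ∉ e.symm '' Metric.closedBall 0 r) :
    tangentMap (𝓡 2) (𝓡 2) (transport e h) p = p := by
  rw [tangentMap_congr (transport_eventuallyEq_id H hr hp), tangentMap_id]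
  rfl

variable [IsManifold (𝓡 2) 1 M]

/-- The coordinates of a tangent vector in a chart of the surface. -/
def tangentCoord (e : OpenPartialHomeomorph M Plane) (p : TangentBundle (𝓡 2) M) :
    Plane × Plane :=
  tangentBundleModelSpaceHomeomorph (𝓡 2) (tangentMap (𝓡 2) (𝓡 2) e p)

lemma continuousOn_tangentCoord {e : OpenPartialHomeomorph M Plane}
    (he : e ∈ IsManifold.maximalAtlas (𝓡 2) 1 M) :
    ContinuousOn (tangentCoord e) (Bundle.TotalSpace.proj ⁻¹' e.source) := by
  have h := (contMDiffOn_of_mem_maximalAtlas he).continuousOn_tangentMapWithin le_rfl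
    e.open_source.uniqueMDiffOn
  refine (tangentBundleModelSpaceHomeomorph (𝓡 2)).continuous.comp_continuousOn
    (h.congr fun p hp => ?_)
  exact (tangentMapWithin_eq_tangentMap (e.open_source.uniqueMDiffOn _ hp)
    ((contMDiffAt_of_mem_maximalAtlas he hp).mdifferentiableAt one_ne_zero)).symm

lemma tangentParam_tangentCoord {e : OpenPartialHomeomorph M Plane}
    (he : e ∈ IsManifold.maximalAtlas (𝓡 2) 1 M) {p : TangentBundle (𝓡 2) M}
    (hp : p.proj ∈ e.source) : tangentParam e (tangentCoord e p) = p := by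
  change tangentMap (𝓡 2) (𝓡 2) e.symm (tangentMap (𝓡 2) (𝓡 2) e p) = p
  rw [← tangentMap_comp_at p (mdifferentiableAt_symm_chart he (e.map_source hp))
    ((contMDiffAt_of_mem_maximalAtlas he hp).mdifferentiableAt one_ne_zero),
    tangentMap_congr (g := id) (by
      filter_upwards [e.open_source.mem_nhds hp] with q hq using e.left_inv hq), tangentMap_id]
  rfl

lemma tangentMap_transport {e : OpenPartialHomeomorph M Plane}
    (he : e ∈ IsManifold.maximalAtlas (𝓡 2) 1 M) {r δ : ℝ} {h : Plane ≃ Plane} [T2Space M]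
    (H : IsSmallAreaMap r δ h) (hr : Metric.closedBall 0 r ⊆ e.target) {q : Plane × Plane}
    (hq : q.1 ∈ e.target) :
    tangentMap (𝓡 2) (𝓡 2) (transport e h) (tangentParam e q) =
      tangentParam e (h q.1, fderiv ℝ h q.1 q.2) := by
  have hd : MDifferentiableAt (𝓡 2) (𝓡 2) h q.1 :=
    (H.contDiff.differentiable one_ne_zero _).mdifferentiableAt
  have h1 : tangentMap (𝓡 2) (𝓡 2) h ⟨q.1, q.2⟩ = ⟨h q.1, fderiv ℝ h q.1 q.2⟩ := by
    rw [tangentMap, mfderiv_eq_fderiv]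
    rfl
  change tangentMap (𝓡 2) (𝓡 2) (transport e h) (tangentMap (𝓡 2) (𝓡 2) e.symm ⟨q.1, q.2⟩) =
    tangentMap (𝓡 2) (𝓡 2) e.symm ⟨h q.1, fderiv ℝ h q.1 q.2⟩
  rw [← h1, ← tangentMap_comp_at (⟨q.1, q.2⟩ : TangentBundle (𝓡 2) Plane)
      ((contMDiff_transport he H hr).mdifferentiable one_ne_zero _)
      (mdifferentiableAt_symm_chart he hq),
    ← tangentMap_comp_at (⟨q.1, q.2⟩ : TangentBundle (𝓡 2) Plane)
      (mdifferentiableAt_symm_chart he (H.apply_mem hr hq)) hd]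
  refine tangentMap_congr ?_
  filter_upwards [e.open_target.mem_nhds hq] with z hz
  simp [transport_of_mem h (e.map_target hz), e.right_inv hz]

/-- In the compact-open topology on the self-maps of the tangent bundle, the tangent map of a
transported diffeomorphism is close to the identity as soon as the diffeomorphism is `C^1`-close to
the identity and its support is small. -/
lemma eventually_mapsTo_tangentMap_transport [T2Space M] {e : OpenPartialHomeomorph M Plane}
    (he : e ∈ IsManifold.maximalAtlas (𝓡 2) 1 M) (h0 : (0 : Plane) ∈ e.target)
    {K U : Set (TangentBundle (𝓡 2) M)} (hK : IsCompact K) (hU : IsOpen U) (hKU : K ⊆ U) :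
    ∀ᶠ s in 𝓝[>] (0 : ℝ), ∀ r, 0 ≤ r → r ≤ s → Metric.closedBall 0 r ⊆ e.target →
      ∀ h : Plane ≃ Plane, IsSmallAreaMap r s h →
        MapsTo (tangentMap (𝓡 2) (𝓡 2) (transport e h)) K U := by
  obtain ⟨ρ, hρ, hρT⟩ := Metric.nhds_basis_closedBall.mem_iff.1 (e.open_target.mem_nhds h0)
  -- the part of `K` over a fixed disc around the centre of the chart, read in the chart
  set K' := K ∩ Bundle.TotalSpace.proj ⁻¹' (e.symm '' Metric.closedBall 0 ρ) with hK'
  have hK'c : IsCompact K' := hK.inter_right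
    ((isCompact_image_closedBall hρT).isClosed.preimage
      (FiberBundle.continuous_proj Plane (TangentSpace (𝓡 2) : M → Type)))
  have hK's : ∀ p ∈ K', p.proj ∈ e.source := by
    rintro p ⟨-, z, hz, hzp⟩
    rw [← hzp]
    exact e.map_target (hρT hz)
  have hLc : IsCompact (tangentCoord e '' K') :=
    hK'c.image_of_continuousOn ((continuousOn_tangentCoord he).mono hK's)
  have hO : IsOpen ((e.target ×ˢ univ) ∩ tangentParam e ⁻¹' U) :=
    (continuousOn_tangentParam he).isOpen_inter_preimage (e.open_target.prod isOpen_univ) hU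
  have hLO : tangentCoord e '' K' ⊆ (e.target ×ˢ univ) ∩ tangentParam e ⁻¹' U := by
    rintro _ ⟨p, hp, rfl⟩
    refine ⟨⟨e.map_source (hK's p hp), mem_univ _⟩, ?_⟩
    rw [mem_preimage, tangentParam_tangentCoord he (hK's p hp)]
    exact hKU hp.1
  obtain ⟨ε, hε, hthick⟩ := hLc.exists_thickening_subset_open hO hLO
  obtain ⟨C, hC⟩ := hLc.exists_bound_of_continuousOn (f := fun q : Plane × Plane => q.2)
    continuous_snd.continuousOn
  have hs1 : ∀ᶠ s in 𝓝[>] (0 : ℝ), s < ρ := nhdsWithin_le_nhds (gt_mem_nhds hρ)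
  have hs2 : ∀ᶠ s in 𝓝[>] (0 : ℝ), 2 * s < ε := by
    have : Tendsto (fun s : ℝ => 2 * s) (𝓝 0) (𝓝 0) := by
      simpa using (tendsto_id (α := ℝ) (x := 𝓝 0)).const_mul 2
    exact nhdsWithin_le_nhds (this.eventually (gt_mem_nhds hε))
  have hs3 : ∀ᶠ s in 𝓝[>] (0 : ℝ), s * C < ε := by
    have : Tendsto (fun s : ℝ => s * C) (𝓝 0) (𝓝 0) := by
      simpa using (tendsto_id (α := ℝ) (x := 𝓝 0)).mul_const C
    exact nhdsWithin_le_nhds (this.eventually (gt_mem_nhds hε))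
  filter_upwards [hs1, hs2, hs3, self_mem_nhdsWithin] with s hsρ hsε hsC hs0 r hr0 hrs hrT h H p hp
  by_cases hpr : p.proj ∈ e.symm '' Metric.closedBall 0 r
  · have hpK' : p ∈ K' := ⟨hp, image_mono (Metric.closedBall_subset_closedBall
      (hrs.trans hsρ.le)) hpr⟩
    have hpq := tangentParam_tangentCoord he (hK's p hpK')
    set q := tangentCoord e p with hq
    have hqL : q ∈ tangentCoord e '' K' := ⟨p, hpK', rfl⟩
    have hqT : q.1 ∈ e.target := (hLO hqL).1.1
    rw [← hpq, tangentMap_transport he H hrT hqT]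
    refine (hthick (Metric.mem_thickening_iff.2 ⟨q, hqL, ?_⟩)).2
    rw [Prod.dist_eq, max_lt_iff, dist_eq_norm, dist_eq_norm]
    constructor
    · exact (H.norm_sub_le hr0 _).trans_lt (by linarith)
    · have h1 : fderiv ℝ h q.1 q.2 - q.2 =
          (fderiv ℝ h q.1 - ContinuousLinearMap.id ℝ Plane) q.2 := rfl
      change ‖fderiv ℝ h q.1 q.2 - q.2‖ < ε
      rw [h1]
      refine lt_of_le_of_lt ?_ hsC
      exact (ContinuousLinearMap.le_opNorm _ _).trans
        (mul_le_mul (H.norm_fderiv_sub_le _) (hC q hqL) (norm_nonneg _) (le_of_lt hs0))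
  · rw [tangentMap_transport_eq_self H hrT hpr]
    exact hKU hp

end TangentMap

/-! ### Perturbations of the identity with prescribed derivatives -/

section Finiteness

variable {M : Type*} [TopologicalSpace M] [ChartedSpace Plane M] [IsManifold (𝓡 2) ∞ M]
  [RiemannianBundle (fun x : M => TangentSpace (𝓡 2) x)]
  [IsContMDiffRiemannianBundle (𝓡 2) 1 Plane (fun x : M => TangentSpace (𝓡 2) x)]
  [MeasurableSpace M] [BorelSpace M] [CompactSpace M] [Nonempty M]

/-- Compactness: every point has a neighbourhood of finite area. -/
lemma areaMeasure_univ_lt_top : areaMeasure M univ < ⊤ := by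
  refine isCompact_univ.measure_lt_top_of_nhdsWithin fun x _ => ?_
  obtain ⟨e, he, hx, -, he1⟩ := exists_areaChart x
  refine ⟨e.source ∩ e ⁻¹' Metric.ball (e x) 1, mem_nhdsWithin_of_mem_nhds
    ((e.isOpen_inter_preimage Metric.isOpen_ball).mem_nhds ⟨hx, by simp⟩), ?_⟩
  rw [areaMeasure_apply_of_areaDensity_eq_one he he1
    (measurableSet_source_inter e measurableSet_ball) inter_subset_left]
  refine lt_of_le_of_lt (measure_mono ?_) (measure_ball_lt_top (x := e x) (r := 1))
  rintro y ⟨hy, -, hy2⟩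
  simpa [e.right_inv hy] using hy2

lemma areaMeasure_univ_ne_zero : areaMeasure M univ ≠ 0 := by
  obtain ⟨x⟩ := ‹Nonempty M›
  obtain ⟨e, he, hx, -, he1⟩ := exists_areaChart x
  have h : 0 < areaMeasure M e.source := by
    rw [areaMeasure_apply_of_areaDensity_eq_one he he1 e.open_source.measurableSet le_rfl]
    have : e.target ∩ e.symm ⁻¹' e.source = e.target :=
      inter_eq_left.2 fun y hy => e.map_target hy
    rw [this]
    exact e.open_target.measure_pos _ ⟨e x, e.map_source hx⟩
  exact (h.trans_le (measure_mono (subset_univ _))).ne'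

/-- The normalization is by a positive finite constant, so it does not affect invariance. -/
lemma measurePreserving_normalizedArea_iff {f : M → M} :
    MeasurePreserving f (normalizedArea M) (normalizedArea M) ↔
      MeasurePreserving f (areaMeasure M) (areaMeasure M) := by
  constructor
  · intro h
    refine ⟨h.measurable, ?_⟩
    ext S hS
    have h1 := congrArg (fun ν : Measure M => ν S) h.map_eq
    simp only [normalizedArea, Measure.map_smul, Measure.smul_apply, smul_eq_mul] at h1
    exact (ENNReal.mul_right_inj (ENNReal.inv_ne_zero.2 areaMeasure_univ_lt_top.ne)
      (ENNReal.inv_ne_top.2 areaMeasure_univ_ne_zero)).1 h1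
  · intro h
    exact h.smul_measure _

end Finiteness

section TangentMapC

variable {M : Type*} [TopologicalSpace M] [ChartedSpace Plane M] [IsManifold (𝓡 2) 1 M]

/-- The tangent map of a diffeomorphism, as a continuous map of the tangent bundle. -/
def tangentMapC (g : Diff1 M) : C(TangentBundle (𝓡 2) M, TangentBundle (𝓡 2) M) :=
  ⟨tangentMap (𝓡 2) (𝓡 2) g, g.contMDiff.continuous_tangentMap le_rfl⟩

lemma tangentMapC_trans (g h : Diff1 M) :
    tangentMapC (g.trans h) = (tangentMapC h).comp (tangentMapC g) := by
  ext1 p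
  exact tangentMap_comp_at p (h.mdifferentiable one_ne_zero _) (g.mdifferentiable one_ne_zero _)

lemma tangentMapC_eq_id {g : Diff1 M} (h : ∀ x, g x = x) :
    tangentMapC g = ContinuousMap.id _ := by
  ext1 p
  change tangentMap (𝓡 2) (𝓡 2) g p = p
  have : (g : M → M) = id := funext h
  rw [this, tangentMap_id]
  rfl

lemma tangentMapC_symm_apply (g : Diff1 M) (p : TangentBundle (𝓡 2) M) :
    tangentMapC g.symm (tangentMapC g p) = p := by
  have h := tangentMapC_trans g g.symm
  rw [tangentMapC_eq_id (fun x => by simp)] at h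
  exact (congrArg (fun F => F p) h).symm

instance : LocallyCompactSpace (TangentBundle (𝓡 2) M) :=
  have : LocallyCompactSpace (ModelProd Plane Plane) :=
    inferInstanceAs (LocallyCompactSpace (Plane × Plane))
  ChartedSpace.locallyCompactSpace (ModelProd Plane Plane) (TangentBundle (𝓡 2) M)

end TangentMapC

section Perturbation

variable {M : Type*} [TopologicalSpace M] [T2Space M] [ChartedSpace Plane M]
  [RiemannianBundle (fun x : M => TangentSpace (𝓡 2) x)]

lemma preservesArea_transportDiffeo [IsManifold (𝓡 2) 1 M] {e : OpenPartialHomeomorph M Plane}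
    (he : e ∈ IsManifold.maximalAtlas (𝓡 2) 1 M) (he1 : ∀ y ∈ e.target, areaDensity e y = 1)
    {r δ : ℝ} {h : Plane ≃ Plane} (H : IsSmallAreaMap r δ h)
    (hr : Metric.closedBall 0 r ⊆ e.target) (x : M) :
    PreservesArea (mfderiv (𝓡 2) (𝓡 2) (transportDiffeo he H hr) x) := by
  by_cases hx : x ∈ e.source
  · have hy := e.map_source hx
    refine preservesArea_of_areaDensity_eq he hx ?_
    rw [areaDensity_comp he (H.contDiff.differentiable one_ne_zero _) (H.apply_mem hr hy), H.abs_det,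
      he1 _ hy, he1 _ (H.apply_mem hr hy), one_mul]
    filter_upwards [e.open_target.mem_nhds hy] with z hz
    rw [pushChart_symm]
    change transport e h (e.symm z) = _
    simp [transport_of_mem h (e.map_target hz), e.right_inv hz]
  · have hc : chartAt Plane x ∈ IsManifold.maximalAtlas (𝓡 2) 1 M :=
      IsManifold.chart_mem_maximalAtlas _
    have hxc := mem_chart_source Plane x
    set c := chartAt Plane x
    refine preservesArea_of_areaDensity_eq hc hxc ?_
    rw [areaDensity_comp hc (τ := id) (y := c x) differentiableAt_id (c.map_source hxc), fderiv_id]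
    · simp [det_plane]
    · have hev : transport e h =ᶠ[𝓝 (c.symm (c x))] id := by
        refine transport_eventuallyEq_id H hr ?_
        rw [c.left_inv hxc]
        rintro ⟨z, hz, hzx⟩
        exact hx (hzx ▸ e.map_target (hr hz))
      filter_upwards [(c.continuousAt_symm (c.map_source hxc)).eventually hev] with z hz
      rw [pushChart_symm]
      exact hz

variable [IsManifold (𝓡 2) ∞ M]
  [IsContMDiffRiemannianBundle (𝓡 2) 1 Plane (fun x : M => TangentSpace (𝓡 2) x)]
  [MeasurableSpace M] [BorelSpace M] [CompactSpace M] [Nonempty M]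

/-- The local version of Franks' lemma for perturbations of the identity. The admissible size `ζ`
of the perturbation of the derivative does not depend on the support `U`. -/
theorem exists_perturbation_at (x : M)
    {𝒱 : Set C(TangentBundle (𝓡 2) M, TangentBundle (𝓡 2) M)}
    (h𝒱 : 𝒱 ∈ 𝓝 (ContinuousMap.id (TangentBundle (𝓡 2) M))) :
    ∃ ζ : ℝ, 0 < ζ ∧ ∀ B : TangentSpace (𝓡 2) x →L[ℝ] TangentSpace (𝓡 2) x, PreservesArea B →
      ‖B - ContinuousLinearMap.id ℝ (TangentSpace (𝓡 2) x)‖ < ζ →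
      ∀ U : Set M, IsOpen U → x ∈ U → ∃ g : Diff1 M,
        MeasurePreserving g (areaMeasure M) (areaMeasure M) ∧
        tangentMapC g ∈ 𝒱 ∧ tangentMapC g.symm ∈ 𝒱 ∧
        (∀ v : TangentSpace (𝓡 2) x, tangentMapC g ⟨x, v⟩ = ⟨x, B v⟩) ∧
        ∀ p : TangentBundle (𝓡 2) M, p.proj ∉ U → tangentMapC g p = p := by
  obtain ⟨e, he, hx, hex, he1⟩ := exists_areaChart x
  have h0 : (0 : Plane) ∈ e.target := hex ▸ e.map_source hx
  obtain rfl : e.symm 0 = x := by rw [← hex, e.left_inv hx]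
  obtain ⟨𝒮, h𝒮fin, h𝒮, h𝒮𝒱⟩ := ContinuousMap.mem_nhds_iff.1 h𝒱
  have hev : ∀ᶠ s in 𝓝[>] (0 : ℝ), ∀ KU ∈ 𝒮, ∀ r, 0 ≤ r → r ≤ s →
      Metric.closedBall 0 r ⊆ e.target → ∀ h : Plane ≃ Plane, IsSmallAreaMap r s h →
        MapsTo (tangentMap (𝓡 2) (𝓡 2) (transport e h)) KU.1 KU.2 :=
    (Filter.eventually_all_finite h𝒮fin).2 fun KU hKU =>
      eventually_mapsTo_tangentMap_transport he h0 (h𝒮 _ _ hKU).1 (h𝒮 _ _ hKU).2.1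
        (h𝒮 _ _ hKU).2.2
  obtain ⟨s, hs, hs0⟩ := (hev.and self_mem_nhdsWithin).exists
  obtain ⟨ζ, hζ, hmap⟩ := exists_isSmallAreaMap hs0
  -- the frame of the chart at the point, as an isomorphism
  have hbij := chartFrame_bijective he h0
  let S : Plane ≃L[ℝ] TangentSpace (𝓡 2) (e.symm 0) :=
    (LinearEquiv.ofBijective (chartFrame e 0 : Plane →ₗ[ℝ] _) hbij).toContinuousLinearEquiv
  have hS : ∀ v, S v = chartFrame e 0 v := fun v => rfl
  set a : ℝ := ‖(S.symm : TangentSpace (𝓡 2) (e.symm 0) →L[ℝ] Plane)‖ with ha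
  set b : ℝ := ‖(S : Plane →L[ℝ] TangentSpace (𝓡 2) (e.symm 0))‖ with hb
  refine ⟨ζ / (1 + a * b), by positivity, fun B hB hBζ U hU hxU => ?_⟩
  set A : Plane →L[ℝ] Plane :=
    (S.symm : TangentSpace (𝓡 2) (e.symm 0) →L[ℝ] Plane).comp (B.comp (chartFrame e 0)) with hA
  have hSA : ∀ v, chartFrame e 0 (A v) = B (chartFrame e 0 v) := fun v => by
    rw [← hS]
    simp [hA]
  have hdet : |A.det| = 1 := by
    have h1 := areaFactor_comp (chartFrame e 0) A
    have h2 : (chartFrame e 0).comp A = B.comp (chartFrame e 0) := ContinuousLinearMap.ext hSA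
    have h3 : areaFactor (chartFrame e 0) = 1 := he1 0 h0
    rw [h2, hB.areaFactor_comp, h3, mul_one] at h1
    exact h1.symm
  have hnorm : ‖A - ContinuousLinearMap.id ℝ Plane‖ < ζ := by
    have h1 : A - ContinuousLinearMap.id ℝ Plane =
        (S.symm : TangentSpace (𝓡 2) (e.symm 0) →L[ℝ] Plane).comp
          ((B - ContinuousLinearMap.id ℝ (TangentSpace (𝓡 2) (e.symm 0))).comp
            (S : Plane →L[ℝ] TangentSpace (𝓡 2) (e.symm 0))) := by
      ext1 v
      simp [hA, ← hS]
    have h2 : ‖A - ContinuousLinearMap.id ℝ Plane‖ ≤ a * (ζ / (1 + a * b) * b) := by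
      rw [h1]
      refine (ContinuousLinearMap.opNorm_comp_le _ _).trans ?_
      gcongr
      refine (ContinuousLinearMap.opNorm_comp_le _ _).trans ?_
      gcongr
    refine h2.trans_lt ?_
    have h3 : 0 ≤ a * b := by positivity
    rw [show a * (ζ / (1 + a * b) * b) = ζ * (a * b) / (1 + a * b) by ring,
      div_lt_iff₀ (by positivity)]
    linarith
  obtain ⟨ρ, hρ, hρU⟩ := Metric.nhds_basis_closedBall.mem_iff.1
    ((e.isOpen_inter_preimage_symm hU).mem_nhds ⟨h0, hxU⟩)
  set r := min s ρ with hr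
  have hr0 : 0 < r := lt_min hs0 hρ
  have hrU : Metric.closedBall 0 r ⊆ e.target ∩ e.symm ⁻¹' U :=
    (Metric.closedBall_subset_closedBall (min_le_right _ _)).trans hρU
  have hrT : Metric.closedBall 0 r ⊆ e.target := hrU.trans inter_subset_left
  obtain ⟨h, H, hh⟩ := hmap A hdet hnorm r hr0
  refine ⟨transportDiffeo he H hrT,
    measurePreserving_of_preservesArea _ (preservesArea_transportDiffeo he he1 H hrT),
    h𝒮𝒱 fun K V hKV => hs _ hKV r hr0.le (min_le_left _ _) hrT h H,
    h𝒮𝒱 fun K V hKV => hs _ hKV r hr0.le (min_le_left _ _) hrT h.symm H.symm,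
    fun v => ?_, fun p hp => ?_⟩
  · have h1 := tangentMap_transport he H hrT (q := (0, S.symm v)) h0
    rw [H.map_zero, hh] at h1
    simp only [tangentParam, hSA] at h1
    rw [← hS, S.apply_symm_apply] at h1
    exact h1
  · refine tangentMap_transport_eq_self H hrT ?_
    rintro ⟨z, hz, hzp⟩
    exact hp (hzp ▸ (hrU hz).2)

/-- Franks' lemma for perturbations of the identity at finitely many points. -/
theorem exists_perturbation {X : Set M} (hX : X.Finite) :
    ∀ 𝒱 ∈ 𝓝 (ContinuousMap.id (TangentBundle (𝓡 2) M)),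
    ∃ ζ : ℝ, 0 < ζ ∧ ∀ B : (x : M) → TangentSpace (𝓡 2) x →L[ℝ] TangentSpace (𝓡 2) x,
      (∀ x ∈ X, PreservesArea (B x)) →
      (∀ x ∈ X, ‖B x - ContinuousLinearMap.id ℝ (TangentSpace (𝓡 2) x)‖ < ζ) →
      ∀ U : Set M, IsOpen U → X ⊆ U → ∃ g : Diff1 M,
        MeasurePreserving g (areaMeasure M) (areaMeasure M) ∧
        tangentMapC g ∈ 𝒱 ∧ tangentMapC g.symm ∈ 𝒱 ∧
        (∀ x ∈ X, ∀ v : TangentSpace (𝓡 2) x, tangentMapC g ⟨x, v⟩ = ⟨x, B x v⟩) ∧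
        ∀ p : TangentBundle (𝓡 2) M, p.proj ∉ U → tangentMapC g p = p := by
  induction X, hX using Set.Finite.induction_on with
  | empty =>
    intro 𝒱 h𝒱
    have hid : tangentMapC (Diffeomorph.refl (𝓡 2) M 1) = ContinuousMap.id _ :=
      tangentMapC_eq_id fun _ => rfl
    refine ⟨1, one_pos, fun B _ _ U _ _ => ⟨Diffeomorph.refl (𝓡 2) M 1,
      MeasurePreserving.id _, ?_, ?_, by simp, fun p _ => ?_⟩⟩
    · rw [hid]
      exact mem_of_mem_nhds h𝒱
    · rw [Diffeomorph.symm_refl, hid]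
      exact mem_of_mem_nhds h𝒱
    · rw [hid]
      rfl
  | @insert a X haX hXfin ih =>
    intro 𝒱 h𝒱
    have hcomp : Tendsto (fun q : C(TangentBundle (𝓡 2) M, TangentBundle (𝓡 2) M) ×
        C(TangentBundle (𝓡 2) M, TangentBundle (𝓡 2) M) => q.2.comp q.1)
        (𝓝 (ContinuousMap.id _) ×ˢ 𝓝 (ContinuousMap.id _)) (𝓝 (ContinuousMap.id _)) := by
      have := (ContinuousMap.continuous_comp' (X := TangentBundle (𝓡 2) M)
        (Y := TangentBundle (𝓡 2) M) (Z := TangentBundle (𝓡 2) M)).tendsto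
        (ContinuousMap.id _, ContinuousMap.id _)
      rwa [nhds_prod_eq, ContinuousMap.comp_id] at this
    obtain ⟨𝒲, h𝒲, h𝒲𝒱⟩ := Filter.mem_prod_same_iff.1 (hcomp h𝒱)
    have hmul : ∀ F ∈ 𝒲, ∀ G ∈ 𝒲, G.comp F ∈ 𝒱 := fun F hF G hG => h𝒲𝒱 (mk_mem_prod hF hG)
    obtain ⟨ζ₁, hζ₁, H₁⟩ := exists_perturbation_at a h𝒲
    obtain ⟨ζ₂, hζ₂, H₂⟩ := ih 𝒲 h𝒲
    refine ⟨min ζ₁ ζ₂, lt_min hζ₁ hζ₂, fun B hB hBζ U hU hXU => ?_⟩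
    -- the perturbation at `a` leaves the points of `X` alone, and conversely
    obtain ⟨g₁, hm₁, h𝒲₁, h𝒲₁', hg₁, hs₁⟩ := H₁ (B a) (hB a (mem_insert _ _))
      ((hBζ a (mem_insert _ _)).trans_le (min_le_left _ _)) (U ∩ Xᶜ)
      (hU.inter hXfin.isClosed.isOpen_compl) ⟨hXU (mem_insert _ _), haX⟩
    obtain ⟨g₂, hm₂, h𝒲₂, h𝒲₂', hg₂, hs₂⟩ := H₂ B (fun x hx => hB x (mem_insert_of_mem _ hx))
      (fun x hx => (hBζ x (mem_insert_of_mem _ hx)).trans_le (min_le_right _ _)) (U ∩ {a}ᶜ)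
      (hU.inter isClosed_singleton.isOpen_compl)
      (fun x hx => ⟨hXU (mem_insert_of_mem _ hx), fun hxa => haX (mem_singleton_iff.1 hxa ▸ hx)⟩)
    have hT : ∀ p, tangentMapC (g₂.trans g₁) p = tangentMapC g₁ (tangentMapC g₂ p) := fun p => by
      rw [tangentMapC_trans]
      rfl
    refine ⟨g₂.trans g₁, hm₁.comp hm₂, ?_, ?_, fun x hx v => ?_, fun p hp => ?_⟩
    · rw [tangentMapC_trans]
      exact hmul _ h𝒲₂ _ h𝒲₁
    · rw [Diffeomorph.symm_trans', tangentMapC_trans]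
      exact hmul _ h𝒲₁' _ h𝒲₂'
    · rw [hT]
      rcases mem_insert_iff.1 hx with rfl | hxX
      · rw [hs₂ _ (fun h => h.2 (mem_singleton _)), hg₁]
      · rw [hg₂ x hxX, hs₁ _ (fun h => h.2 hxX)]
    · rw [hT, hs₂ p (fun h => hp h.1), hs₁ p (fun h => hp h.1)]

end Perturbation

/-! ### Reversible perturbations -/

section Reversible

variable {M : Type*} [TopologicalSpace M] [ChartedSpace Plane M]

/-- The perturbation `R ∘ h⁻¹ ∘ R ∘ f ∘ h` of `f`. It is reversible by construction, and
coincides with `f ∘ h` wherever `R ∘ f` avoids the support of `h`. -/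
def reversiblePerturbation (R f h : Diff1 M) : Diff1 M :=
  h.trans (f.trans (R.trans (h.symm.trans R)))

lemma reversiblePerturbation_apply (R f h : Diff1 M) (x : M) :
    reversiblePerturbation R f h x = R (h.symm (R (f (h x)))) := rfl

variable [CompactSpace M] [Nonempty M] [IsManifold (𝓡 2) ∞ M]
  [RiemannianBundle (fun x : M => TangentSpace (𝓡 2) x)]
  [IsContMDiffRiemannianBundle (𝓡 2) 1 Plane (fun x : M => TangentSpace (𝓡 2) x)]
  [MeasurableSpace M] [BorelSpace M]

lemma isAreaPreservingReversible_reversiblePerturbation {R : Diff1 M} (hR : ∀ x, R (R x) = x)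
    (hRm : MeasurePreserving R (areaMeasure M) (areaMeasure M)) {f : Diff1 M}
    (hf : IsAreaPreservingReversible R f) {h : Diff1 M}
    (hh : MeasurePreserving h (areaMeasure M) (areaMeasure M)) :
    IsAreaPreservingReversible R (reversiblePerturbation R f h) := by
  have hh' : MeasurePreserving h.symm (areaMeasure M) (areaMeasure M) :=
    MeasurePreserving.symm h.toHomeomorph.toMeasurableEquiv hh
  have hfm := measurePreserving_normalizedArea_iff.1 hf.measurePreserving
  refine ⟨measurePreserving_normalizedArea_iff.2
    (hRm.comp (hh'.comp (hRm.comp (hfm.comp hh)))), fun x => ?_⟩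
  have hg : reversiblePerturbation R f h (R (reversiblePerturbation R f h x)) = R x := by
    simp [reversiblePerturbation_apply, hR, hf.reversible]
  rw [← hg, Diffeomorph.symm_apply_apply]

/-- Franks' lemma for reversible area-preserving surface diffeomorphisms. Freeness of `X` is what
makes `R ∘ h⁻¹ ∘ R ∘ f ∘ h` have the derivative of `f ∘ h` at the points of `X`. -/
theorem exists_reversible_perturbation [T2Space M] (R : Diff1 M) (hR : ∀ x, R (R x) = x)
    (hRarea : ∀ x, PreservesArea (mfderiv (𝓡 2) (𝓡 2) R x))
    (f : Diff1 M) (hf : IsAreaPreservingReversible R f)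
    {X : Set M} (hXfin : X.Finite) (hXfree : IsFree R f X)
    {𝒰 : Set (Diff1 M)} (h𝒰 : 𝒰 ∈ @nhds (Diff1 M) c1Topology f) :
    ∃ ζ : ℝ, 0 < ζ ∧
      ∀ P : (x : M) → TangentSpace (𝓡 2) x →L[ℝ] TangentSpace (𝓡 2) (f x),
        (∀ x ∈ X, PreservesArea (P x)) →
        (∀ x ∈ X, ‖P x - mfderiv (𝓡 2) (𝓡 2) f x‖ < ζ) →
        ∀ K : Set M, IsCompact K → Disjoint K X → (∀ x ∈ X, ¬ AccPt (R (f x)) (𝓟 K)) →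
          ∃ g : Diff1 M, g ∈ 𝒰 ∧ IsAreaPreservingReversible R g ∧
            (∀ x ∈ X, ∀ v : TangentSpace (𝓡 2) x,
              tangentMap (𝓡 2) (𝓡 2) g ⟨x, v⟩ = ⟨f x, P x v⟩) ∧
            ∀ y ∈ K, g y = f y := by
  have hRm := measurePreserving_of_preservesArea R hRarea
  have hfm := measurePreserving_normalizedArea_iff.1 hf.measurePreserving
  have : IsContinuousRiemannianBundle Plane (fun x : M => TangentSpace (𝓡 2) x) := by
    obtain ⟨m, hm, hm'⟩ := IsContMDiffRiemannianBundle.exists_contMDiff (IB := 𝓡 2) (n := 1)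
      (F := Plane) (E := fun x : M => TangentSpace (𝓡 2) x)
    exact ⟨m, hm.continuous, hm'⟩
  have hfarea := preservesArea_of_measurePreserving f hfm
  -- `R ∘ f` is an involution
  have hRf : ∀ y, R (f (R (f y))) = y := fun y => by
    rw [hf.reversible, hR, Diffeomorph.symm_apply_apply]
  have hTR : (tangentMapC R).comp (tangentMapC R) = ContinuousMap.id _ := by
    rw [← tangentMapC_trans, tangentMapC_eq_id hR]
  have hTg : ∀ h : Diff1 M, tangentMapC (reversiblePerturbation R f h) = (tangentMapC R).comp
      ((tangentMapC h.symm).comp ((tangentMapC R).comp ((tangentMapC f).comp (tangentMapC h)))) :=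
    fun h => by
      simp only [reversiblePerturbation, tangentMapC_trans, ContinuousMap.comp_assoc]
  -- closeness of `h` and `h.symm` to the identity implies closeness of the perturbation to `f`
  obtain ⟨𝒱, h𝒱, h𝒱𝒰⟩ : ∃ 𝒱 ∈ 𝓝 (ContinuousMap.id (TangentBundle (𝓡 2) M)),
      ∀ h : Diff1 M, tangentMapC h ∈ 𝒱 → tangentMapC h.symm ∈ 𝒱 →
        reversiblePerturbation R f h ∈ 𝒰 := by
    rw [c1Topology, nhds_induced, Filter.mem_comap] at h𝒰
    obtain ⟨𝒩, h𝒩, h𝒩𝒰⟩ := h𝒰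
    have hcont : Continuous fun q : C(TangentBundle (𝓡 2) M, TangentBundle (𝓡 2) M) ×
        C(TangentBundle (𝓡 2) M, TangentBundle (𝓡 2) M) =>
        (tangentMapC R).comp (q.2.comp ((tangentMapC R).comp ((tangentMapC f).comp q.1))) :=
      continuous_const.compCM (continuous_snd.compCM
        (continuous_const.compCM (continuous_const.compCM continuous_fst)))
    have hlim := hcont.tendsto (ContinuousMap.id _, ContinuousMap.id _)
    simp only [ContinuousMap.id_comp, ContinuousMap.comp_id] at hlim
    rw [← ContinuousMap.comp_assoc, hTR, ContinuousMap.id_comp, nhds_prod_eq] at hlim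
    obtain ⟨𝒱, h𝒱, hsub⟩ := Filter.mem_prod_same_iff.1 (hlim h𝒩)
    refine ⟨𝒱, h𝒱, fun h h1 h2 => h𝒩𝒰 ?_⟩
    change tangentMapC (reversiblePerturbation R f h) ∈ 𝒩
    rw [hTg]
    exact hsub (mk_mem_prod h1 h2)
  obtain ⟨ζ, hζ, hpert⟩ := exists_perturbation hXfin 𝒱 h𝒱
  let D : (x : M) → TangentSpace (𝓡 2) x ≃L[ℝ] TangentSpace (𝓡 2) (f x) := fun x =>
    f.mfderivToContinuousLinearEquiv one_ne_zero x
  have hD : ∀ x v, D x v = mfderiv (𝓡 2) (𝓡 2) f x v := fun x v => rfl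
  obtain ⟨C, hC⟩ := (hXfin.image fun x =>
    ‖((D x).symm : TangentSpace (𝓡 2) (f x) →L[ℝ] TangentSpace (𝓡 2) x)‖).bddAbove
  have hC' : ∀ x ∈ X,
      ‖((D x).symm : TangentSpace (𝓡 2) (f x) →L[ℝ] TangentSpace (𝓡 2) x)‖ ≤ |C| := fun x hx =>
    (hC (mem_image_of_mem _ hx)).trans (le_abs_self C)
  refine ⟨ζ / (1 + |C|), by positivity, fun P hP hPζ K hK hKX hacc => ?_⟩
  set B : (x : M) → TangentSpace (𝓡 2) x →L[ℝ] TangentSpace (𝓡 2) x := fun x =>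
    ((D x).symm : TangentSpace (𝓡 2) (f x) →L[ℝ] TangentSpace (𝓡 2) x).comp (P x) with hBdef
  have hDB : ∀ x v, mfderiv (𝓡 2) (𝓡 2) f x (B x v) = P x v := fun x v => by
    rw [← hD]
    simp [hBdef]
  have hBarea : ∀ x ∈ X, PreservesArea (B x) := fun x hx v w => by
    rw [← hfarea x (B x v) (B x w), hDB, hDB, hP x hx]
  have hBζ : ∀ x ∈ X, ‖B x - ContinuousLinearMap.id ℝ (TangentSpace (𝓡 2) x)‖ < ζ := by
    intro x hx
    have h1 : B x - ContinuousLinearMap.id ℝ (TangentSpace (𝓡 2) x) =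
        ((D x).symm : TangentSpace (𝓡 2) (f x) →L[ℝ] TangentSpace (𝓡 2) x).comp
          (P x - mfderiv (𝓡 2) (𝓡 2) f x) := by
      ext1 v
      simp [hBdef, ← hD]
    have h2 : ‖B x - ContinuousLinearMap.id ℝ (TangentSpace (𝓡 2) x)‖ ≤ |C| * (ζ / (1 + |C|)) := by
      rw [h1]
      refine (ContinuousLinearMap.opNorm_comp_le _ _).trans ?_
      exact mul_le_mul (hC' x hx) (hPζ x hx).le (norm_nonneg _) (abs_nonneg _)
    refine h2.trans_lt ?_
    rw [show |C| * (ζ / (1 + |C|)) = ζ * |C| / (1 + |C|) by ring, div_lt_iff₀ (by positivity)]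
    linarith
  -- a neighbourhood of `X` that avoids `K` and `R (f X)`, and whose image by `R ∘ f` meets `K` at
  -- most along `R (f X)`
  obtain ⟨U, hU, hXU, hUK, hURf, hUacc⟩ : ∃ U : Set M, IsOpen U ∧ X ⊆ U ∧ Disjoint K U ∧
      (∀ x ∈ X, R (f x) ∉ U) ∧ ∀ z ∈ U, R (f z) ∈ K → z ∈ X := by
    have hloc : ∀ x ∈ X, ∀ᶠ z in 𝓝 x, R (f z) ∈ K → z ∈ X := by
      intro x hx
      have h1 : ∀ᶠ y in 𝓝 (R (f x)), y ∈ K → y = R (f x) := by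
        have := hacc x hx
        rw [accPt_iff_frequently, Filter.not_frequently] at this
        filter_upwards [this] with y hy hyK
        by_contra hne
        exact hy ⟨hne, hyK⟩
      have h2 : ContinuousAt (fun z => R (f z)) x :=
        (R.continuous.comp f.continuous).continuousAt
      filter_upwards [h2.eventually h1] with z hz hzK
      have h3 := congrArg (fun y => R (f y)) (hz hzK)
      simp only [hRf] at h3
      rwa [h3]
    have hset : ∃ O : Set M, IsOpen O ∧ X ⊆ O ∧ ∀ z ∈ O, R (f z) ∈ K → z ∈ X := by
      have := Filter.eventually_iff.1 (eventually_nhdsSet_iff_forall.2 hloc)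
      obtain ⟨O, hO, hXO, hOs⟩ := mem_nhdsSet_iff_exists.1 this
      exact ⟨O, hO, hXO, fun z hz => hOs hz⟩
    obtain ⟨O, hO, hXO, hOK⟩ := hset
    have hfin : ((fun x => R (f x)) '' X).Finite := hXfin.image _
    refine ⟨O ∩ Kᶜ ∩ ((fun x => R (f x)) '' X)ᶜ,
      (hO.inter hK.isClosed.isOpen_compl).inter hfin.isClosed.isOpen_compl, fun x hx =>
      ⟨⟨hXO hx, fun hxK => hKX.le_bot ⟨hxK, hx⟩⟩, ?_⟩, ?_, ?_, fun z hz => hOK z hz.1.1⟩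
    · rintro ⟨y, hy, hyx⟩
      refine hXfree y hy x hx ?_
      rw [← hyx]
      exact (hR _).symm
    · exact disjoint_left.2 fun y hyK hy => hy.1.2 hyK
    · exact fun x hx h => h.2 (mem_image_of_mem _ hx)
  obtain ⟨h, hm, h1, h2, hhX, hhU⟩ := hpert B hBarea hBζ U hU hXU
  have hhU' : ∀ p : TangentBundle (𝓡 2) M, p.proj ∉ U → tangentMapC h.symm p = p := fun p hp => by
    conv_lhs => rw [← hhU p hp]
    exact tangentMapC_symm_apply h p
  have hfix : ∀ y ∉ U, h y = y := fun y hy => congrArg Bundle.TotalSpace.proj (hhU ⟨y, 0⟩ hy)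
  have hfixX : ∀ x ∈ X, h x = x := fun x hx =>
    congrArg Bundle.TotalSpace.proj (hhX x hx (0 : TangentSpace (𝓡 2) x))
  refine ⟨reversiblePerturbation R f h, h𝒱𝒰 h h1 h2,
    isAreaPreservingReversible_reversiblePerturbation hR hRm hf hm, fun x hx v => ?_,
    fun y hy => ?_⟩
  · change tangentMapC (reversiblePerturbation R f h) ⟨x, v⟩ = _
    have hfx : tangentMapC f ⟨x, B x v⟩ = ⟨f x, P x v⟩ := by
      rw [← hDB]
      rfl
    rw [hTg]
    simp only [ContinuousMap.comp_apply]
    rw [hhX x hx, hfx, hhU' _ (hURf x hx)]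
    exact congrArg (fun F => F (⟨f x, P x v⟩ : TangentBundle (𝓡 2) M)) hTR
  · have hyU : y ∉ U := fun h => hUK.le_bot ⟨hy, h⟩
    have hz : h.symm (R (f y)) = R (f y) := by
      have hz' : h (R (f y)) = R (f y) := by
        by_cases hzU : R (f y) ∈ U
        · exact hfixX _ (hUacc _ hzU (by rwa [hRf]))
        · exact hfix _ hzU
      conv_lhs => rw [← hz']
      exact h.symm_apply_apply _
    rw [reversiblePerturbation_apply, hfix y hyU, hz, hR]

end Reversible

end ReversibleSurface

end

theorem mainTheorem5
    {M : Type*} [TopologicalSpace M] [T2Space M] [CompactSpace M] [ConnectedSpace M]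
    [ChartedSpace ReversibleSurface.Plane M] [IsManifold (𝓡 2) ∞ M]
    [RiemannianBundle (fun x : M => TangentSpace (𝓡 2) x)]
    [IsContMDiffRiemannianBundle (𝓡 2) ∞ ReversibleSurface.Plane
      (fun x : M => TangentSpace (𝓡 2) x)]
    [MeasurableSpace M] [BorelSpace M]
    (R : ReversibleSurface.Diff1 M) (hR : ∀ x, R (R x) = x)
    (hRarea : ∀ x, ReversibleSurface.PreservesArea (mfderiv (𝓡 2) (𝓡 2) R x))
    (f : ReversibleSurface.Diff1 M)
    (hf : ReversibleSurface.IsAreaPreservingReversible R f)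
    (X : Set M) (hXfin : X.Finite) (hXfree : ReversibleSurface.IsFree R f X)
    (hXper : ∀ x ∈ X, x ∉ Function.periodicPts f)
    (𝒰 : Set (ReversibleSurface.Diff1 M))
    (h𝒰 : 𝒰 ∈ @nhds (ReversibleSurface.Diff1 M) ReversibleSurface.c1Topology f) :
    ∃ ζ : ℝ, 0 < ζ ∧
      ∀ P : (x : M) → TangentSpace (𝓡 2) x →L[ℝ] TangentSpace (𝓡 2) (f x),
        (∀ x ∈ X, ReversibleSurface.PreservesArea (P x)) →
        (∀ x ∈ X, ‖P x - mfderiv (𝓡 2) (𝓡 2) f x‖ < ζ) →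
        ∀ K : Set M, IsCompact K → Disjoint K X →
          (∀ x ∈ X, ¬ AccPt (R (f x)) (𝓟 K)) →
          ∃ g : ReversibleSurface.Diff1 M,
            g ∈ 𝒰 ∧
            ReversibleSurface.IsAreaPreservingReversible R g ∧
            (∀ x ∈ X, ∀ v : TangentSpace (𝓡 2) x,
              tangentMap (𝓡 2) (𝓡 2) g ⟨x, v⟩ = ⟨f x, P x v⟩) ∧
            ∀ y ∈ K, g y = f y := by
  have : IsContMDiffRiemannianBundle (𝓡 2) 1 ReversibleSurface.Plane
      (fun x : M => TangentSpace (𝓡 2) x) :=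
    IsContMDiffRiemannianBundle.of_le (n := ∞) ENat.LEInfty.out
  exact ReversibleSurface.exists_reversible_perturbation R hR hRarea f hf hXfin hXfree h𝒰
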